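/- Let $(A,\mathfrak m)$ be a commutative Noetherian local ring with infinite residue field and let $I\subsetneq A$ be an ideal. Let $$G(I)=\bigoplus_{n\ge 0} I^n/I^{n+1},\qquad F(I)=\bigoplus_{n\ge 0} I^n/\mathfrak m I^n$$ be the associated graded ring and the fiber cone of $I$, and let $\ell=\dim F(I)$ be the analytic spread of $I$; assume $\ell>0$. For an ideal $J$ of a Noetherian ring $S$, $\operatorname{grade} J$ denotes the supremum of the lengths of $S$-regular sequences contained in $J$. For a graded ring $S=\bigoplus_{n\ge0}S_n$, $S_+$ denotes the ideal generated by the homogeneous elements of positive degree, and $\operatorname{depth}F(I)=\operatorname{grade}F(I)_+$. For a standard graded Noetherian ring $S$ put $a_i(S)=\max\{n\in\mathbb Z : [H^i_{S_+}(S)]_n\neq 0\}$ (with $a_i(S)=-\infty$ if $H^i_{S_+}(S)=0$), where $H^i_{S_+}$ is the $i$-th local cohomology with support in $S_+$, and let $\operatorname{reg}S=\max\{a_i(S)+i : i\ge 0\}$ be the Castelnuovo–Mumford regularity. Suppose that $\operatorname{grade} I=\ell$ and $\operatorname{grade} G(I)_+\ge \ell-1$. Then $\operatorname{reg}F(I)\ge\operatorname{reg}G(I)$.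 If, moreover, $\operatorname{depth}F(I)\ge \ell-1$, then $\operatorname{reg}F(I)=\operatorname{reg}G(I)$. -/

import Mathlib

noncomputable section

namespace FiberConeReg

open IsLocalRing

/-! ### Grade of an ideal -/

/-- The grade of an ideal `J` of a (Noetherian) ring `S`: the supremum of the lengths of the
`S`-regular sequences contained in `J`. -/
def grade {S : Type*} [CommRing S] (J : Ideal S) : ℕ∞ :=
  sSup {N : ℕ∞ | ∃ rs : List S, (∀ x ∈ rs, x ∈ J) ∧ RingTheory.Sequence.IsRegular S rs ∧
    N = (rs.length : ℕ∞)}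

/-- The ideal `S₊` generated by the homogeneous elements of positive degree. -/
def irrelevantIdeal {S : Type*} [CommRing S] (𝒜 : ℕ → AddSubgroup S) : Ideal S :=
  Ideal.span {x : S | ∃ n : ℕ, 0 < n ∧ x ∈ 𝒜 n}

/-! ### Graded local cohomology through the Čech complex -/

section Cech

variable {S : Type*} [CommRing S] {r : ℕ} (f : Fin r → S)

/-- The product `f_s` of the elements `f i`, `i ∈ s`. -/
def prodOn (s : Finset (Fin r)) : S := ∏ i ∈ s, f i

variable (M : Type*) [AddCommGroup M] [Module S M]

/-- The localization `M_{f_s}`. -/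
abbrev LocAt (s : Finset (Fin r)) : Type _ :=
  LocalizedModule (Submonoid.powers (prodOn f s)) M

theorem isUnit_algebraMap_of_subset {s t : Finset (Fin r)} (h : s ⊆ t)
    (x : Submonoid.powers (prodOn f s)) :
    IsUnit (algebraMap S (Module.End S (LocAt f M t)) x) := by
  obtain ⟨_, k, rfl⟩ := x
  have hdvd : prodOn f s ∣ prodOn f t := Finset.prod_dvd_prod_of_subset s t f h
  have hu : IsUnit (algebraMap S (Module.End S (LocAt f M t)) (prodOn f t)) :=
    IsLocalizedModule.map_units (LocalizedModule.mkLinearMap (Submonoid.powers (prodOn f t)) M)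
      ⟨prodOn f t, Submonoid.mem_powers _⟩
  obtain ⟨c, hc⟩ := hdvd
  have hcomm : Commute (algebraMap S (Module.End S (LocAt f M t)) (prodOn f s))
      (algebraMap S (Module.End S (LocAt f M t)) c) := by
    rw [Commute, SemiconjBy, ← map_mul, ← map_mul, mul_comm]
  have hc' := congrArg (algebraMap S (Module.End S (LocAt f M t))) hc
  rw [hc', map_mul, hcomm.isUnit_mul_iff] at hu
  simpa only [map_pow] using hu.1.pow k

/-- The canonical map `M_{f_s} → M_{f_t}` for `s ⊆ t`. -/
def locMap {s t : Finset (Fin r)} (h : s ⊆ t) : LocAt f M s →ₗ[S] LocAt f M t :=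
  LocalizedModule.lift (Submonoid.powers (prodOn f s))
    (LocalizedModule.mkLinearMap (Submonoid.powers (prodOn f t)) M)
    (isUnit_algebraMap_of_subset f M h)

/-- The Čech cochains `C^p(f; M) = ⨁_{|s| = p} M_{f_s}`; in particular `C^0 = M`. -/
abbrev CechCochain (p : ℕ) : Type _ :=
  (s : {s : Finset (Fin r) // s.card = p}) → LocAt f M s.1

/-- The Čech differential: for `t = {i_0 < ⋯ < i_p}`, the component of `d c` at `t` is
`∑_j (-1)^j c_{t ∖ {i_j}}`, where `j` is the number of elements of `t` below `i_j`. -/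
def cechD (p : ℕ) : CechCochain f M p →ₗ[S] CechCochain f M (p + 1) :=
  LinearMap.pi fun t => ∑ i ∈ t.1.attach,
    ((-1 : ℤ) ^ (t.1.filter (· < i.1)).card) •
      (locMap f M (Finset.erase_subset i.1 t.1) ∘ₗ
        LinearMap.proj (R := S) (φ := fun s : {s : Finset (Fin r) // s.card = p} => LocAt f M s.1)
          ⟨t.1.erase i.1, by rw [Finset.card_erase_of_mem i.2, t.2]; rfl⟩)

variable {M} (ℳ : ℕ → AddSubgroup M)

/-- For `f i` of degree one: the degree `n` part of `M_{f_s}`, `n ∈ ℤ`, generated by the fractions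
`m / f_s ^ k` with `m` homogeneous of degree `n + k |s|`. -/
def locPiece (s : Finset (Fin r)) (n : ℤ) : AddSubgroup (LocAt f M s) :=
  AddSubgroup.closure {z | ∃ (k d : ℕ) (m : M), m ∈ ℳ d ∧ (d : ℤ) = n + k * s.card ∧
    z = LocalizedModule.mk m ⟨prodOn f s ^ k, pow_mem (Submonoid.mem_powers _) k⟩}

/-- The degree `n` part of `C^p(f; M)`. -/
def cochainPiece (p : ℕ) (n : ℤ) : AddSubgroup (CechCochain f M p) :=
  AddSubgroup.pi Set.univ fun s => locPiece f ℳ s.1 n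

/-- The degree `n` part of the cocycles. -/
def cocyclePiece (p : ℕ) (n : ℤ) : AddSubgroup (CechCochain f M p) :=
  cochainPiece f ℳ p n ⊓ (cechD f M p).toAddMonoidHom.ker

/-- The degree `n` part of the coboundaries. -/
def coboundaryPiece : (p : ℕ) → (n : ℤ) → AddSubgroup (CechCochain f M p)
  | 0, _ => ⊥
  | p + 1, n => (cochainPiece f ℳ p n).map (cechD f M p).toAddMonoidHom

/-- The degree `n` part of the `p`-th cohomology of the Čech complex `C(f; M)`. -/
abbrev CechCohomology (p : ℕ) (n : ℤ) : Type _ :=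
  cocyclePiece f ℳ p n ⧸ (coboundaryPiece f ℳ p n).addSubgroupOf (cocyclePiece f ℳ p n)

end Cech

/-! ### Castelnuovo–Mumford regularity -/

section Regularity

variable {S M : Type*} [CommRing S] [AddCommGroup M] [Module S M]

/-- `f` is a finite system of generators of `S₊` consisting of elements of degree one. -/
def IsStandardGenerators (𝒜 : ℕ → AddSubgroup S) {r : ℕ} (f : Fin r → S) : Prop :=
  (∀ i, f i ∈ 𝒜 1) ∧ Ideal.span (Set.range f) = irrelevantIdeal 𝒜

/-- `[H^i_{S₊}(M)]_n ≠ 0`, for a finitely generated standard graded ring `S`. The local cohomology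
is that of the Čech complex on a finite system of degree-one generators of `S₊`; as a graded module
it does not depend on the system. -/
def LocalCohomologyNeZero (𝒜 : ℕ → AddSubgroup S) (ℳ : ℕ → AddSubgroup M) (i : ℕ) (n : ℤ) :
    Prop :=
  ∃ (r : ℕ) (f : Fin r → S), IsStandardGenerators 𝒜 f ∧ Nontrivial (CechCohomology f ℳ i n)

/-- `a_i(M) = max {n | [H^i_{S₊}(M)]_n ≠ 0}`, which is `⊥ = -∞` if `H^i_{S₊}(M) = 0`. -/
def aInvariant (𝒜 : ℕ → AddSubgroup S) (ℳ : ℕ → AddSubgroup M) (i : ℕ) : WithBot (WithTop ℤ) :=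
  sSup {x | ∃ n : ℤ, LocalCohomologyNeZero 𝒜 ℳ i n ∧ x = ((n : WithTop ℤ) : WithBot (WithTop ℤ))}

/-- `reg M = max {a_i(M) + i | i ≥ 0}`. -/
def reg (𝒜 : ℕ → AddSubgroup S) (ℳ : ℕ → AddSubgroup M) : WithBot (WithTop ℤ) :=
  ⨆ i : ℕ, aInvariant 𝒜 ℳ i + (((i : ℤ) : WithTop ℤ) : WithBot (WithTop ℤ))

end Regularity

/-! ### Associated graded ring and fiber cone -/

section Blowup

universe u
variable {A : Type u} [CommRing A] (I J : Ideal A)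

/-- `R(I) / J R(I) = ⨁ₙ Iⁿ / J Iⁿ`, where `R(I) = ⨁ₙ Iⁿ tⁿ` is the Rees algebra. -/
abbrev ReesQuotient : Type u := reesAlgebra I ⧸ J.map (algebraMap A (reesAlgebra I))

/-- The degree `n` part `Iⁿ tⁿ` of the Rees algebra. -/
def reesPiece (n : ℕ) : AddSubgroup (reesAlgebra I) :=
  (Polynomial.monomial n : A →ₗ[A] Polynomial A).toAddMonoidHom.range.comap
    (reesAlgebra I).val.toRingHom.toAddMonoidHom

/-- The degree `n` part `Iⁿ / J Iⁿ` of `R(I) / J R(I)`. -/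
def reesQuotientPiece (n : ℕ) : AddSubgroup (ReesQuotient I J) :=
  (reesPiece I n).map (Ideal.Quotient.mk (J.map (algebraMap A (reesAlgebra I)))).toAddMonoidHom

/-- The associated graded ring `G(I) = ⨁ₙ Iⁿ / Iⁿ⁺¹`. -/
abbrev AssocGraded : Type u := ReesQuotient I I

/-- The grading of `G(I)`. -/
abbrev assocGradedPiece : ℕ → AddSubgroup (AssocGraded I) := reesQuotientPiece I I

/-- `grade G(I)₊`. -/
def gradeAssocGradedPlus : ℕ∞ :=
  grade (irrelevantIdeal (S := AssocGraded I) (assocGradedPiece I))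

/-- `reg G(I)`. -/
def regAssocGraded : WithBot (WithTop ℤ) :=
  reg (S := AssocGraded I) (M := AssocGraded I) (assocGradedPiece I) (assocGradedPiece I)

variable [IsLocalRing A]

/-- The fiber cone `F(I) = ⨁ₙ Iⁿ / 𝔪 Iⁿ`. -/
abbrev FiberCone : Type u := ReesQuotient I (maximalIdeal A)

/-- The grading of `F(I)`. -/
abbrev fiberConePiece : ℕ → AddSubgroup (FiberCone I) := reesQuotientPiece I (maximalIdeal A)

/-- The analytic spread `ℓ(I) = dim F(I)`. -/
def analyticSpread : WithBot ℕ∞ := ringKrullDim (FiberCone I)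

/-- `reg F(I)`. -/
def regFiberCone : WithBot (WithTop ℤ) :=
  reg (S := FiberCone I) (M := FiberCone I) (fiberConePiece I) (fiberConePiece I)

/-- `depth F(I)`: the grade of the maximal homogeneous ideal `F(I)₊` (note `F(I)₀ = A/𝔪`). -/
def depthFiberCone : ℕ∞ :=
  grade (irrelevantIdeal (S := FiberCone I) (fiberConePiece I))

end Blowup

end FiberConeReg

end

/-! Choose general elements x_1, …, x_l of I and put Q = (x_1, …, x_{l-1}). As the residue field is
infinite and grade G(I)₊ ≥ l-1, the forms x_i t with i < l can be made a regular sequence on G(I)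
while all l forms are filter-regular on F(I). A filter-regular sequence of length dim F(I) leaves a
quotient in which F(I)₊ is nilpotent, so by Nakayama (Q, x_l) is a reduction of I. Let r be its
reduction number. Then reg G(I) = r ≤ reg F(I), and reg F(I) ≤ r once depth F(I) ≥ l-1.

Two facts on regularity come from the Čech complexes of S and S/xS, for a linear form x with torsion
kernel. Vanishing of H^p in degree n for all n + p > R passes from S to S/xS; since S modulo all l
forms is torsion and, by minimality of r, nonzero in degree r, this gives r ≤ reg
(`le_reg_of_chain`). Conversely, vanishing passes from S/xS to S if x is injective in degrees > R:
multiplication by x is then injective on the relevant cohomology, where it is also torsion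
(`vanishes_of_section`, `reg_le_of_chain`).

For the upper bound, x_l t must act injectively in degrees > r modulo the forms from Q. Regular
leading forms give Q ∩ I^(n+1) = Q I^n (Valabrega–Valla) and make x_1, …, x_{l-1} regular on A;
grade I = l then makes x_l regular modulo Q. Writing I^(n+1) = (Q, x_l) I^n for n ≥ r allows x_l to
be cancelled, for G(I) and F(I) alike (`mem_stage_of_mul_mem_stage`). On F(I) the first l-1 forms
are regular under the depth hypothesis, since filter-regular elements are regular while depth
remains. -/

noncomputable section

namespace FiberConeReg

/-! ### Fractions and homogeneous fractions -/

section Fractions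

variable {S : Type*} [CommRing S] {r : ℕ} (f : Fin r → S)
variable {M N : Type*} [AddCommGroup M] [Module S M] [AddCommGroup N] [Module S N]

/-- The fraction `m / f_s ^ k` in `M_{f_s}`. -/
def frac (s : Finset (Fin r)) (m : M) (k : ℕ) : LocAt f M s :=
  LocalizedModule.mk m ⟨prodOn f s ^ k, pow_mem (Submonoid.mem_powers _) k⟩

variable {f}

theorem exists_eq_frac {s : Finset (Fin r)} (z : LocAt f M s) :
    ∃ (m : M) (k : ℕ), z = frac f s m k := by
  induction z using LocalizedModule.induction_on with
  | _ m u =>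
    obtain ⟨_, k, rfl⟩ := u
    exact ⟨m, k, rfl⟩

theorem smul_frac (x : S) (s : Finset (Fin r)) (m : M) (k : ℕ) :
    x • frac f s m k = frac f s (x • m) k :=
  LocalizedModule.smul'_mk _ _ _

theorem frac_eq_mk' (s : Finset (Fin r)) (m : M) (k : ℕ) :
    frac f s m k = IsLocalizedModule.mk'
      (LocalizedModule.mkLinearMap (Submonoid.powers (prodOn f s)) M) m
      ⟨prodOn f s ^ k, pow_mem (Submonoid.mem_powers _) k⟩ :=
  IsLocalizedModule.mk_eq_mk' _ _

theorem frac_add (s : Finset (Fin r)) (m m' : M) (k : ℕ) :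
    frac f s (m + m') k = frac f s m k + frac f s m' k := by
  simp only [frac_eq_mk']
  exact IsLocalizedModule.mk'_add _ _ _ _

theorem frac_zero (s : Finset (Fin r)) (k : ℕ) : frac f s (0 : M) k = 0 :=
  LocalizedModule.zero_mk _

theorem frac_neg (s : Finset (Fin r)) (m : M) (k : ℕ) :
    frac f s (-m) k = - frac f s m k := by
  simp only [frac_eq_mk']
  exact IsLocalizedModule.mk'_neg _ _ _

theorem frac_shift (s : Finset (Fin r)) (m : M) (k a : ℕ) :
    frac f s (prodOn f s ^ a • m) (k + a) = frac f s m k := by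
  have := LocalizedModule.mk_cancel_common_right
    (⟨prodOn f s ^ k, pow_mem (Submonoid.mem_powers _) k⟩ : Submonoid.powers (prodOn f s))
    ⟨prodOn f s ^ a, pow_mem (Submonoid.mem_powers _) a⟩ m
  rw [frac, frac, ← this]
  congr 1
  exact Subtype.ext (pow_add _ _ _)

theorem frac_eq_zero_iff {s : Finset (Fin r)} {m : M} {k : ℕ} :
    frac f s m k = 0 ↔ ∃ a : ℕ, prodOn f s ^ a • m = 0 := by
  rw [frac_eq_mk', IsLocalizedModule.mk'_eq_zero']
  constructor
  · rintro ⟨⟨_, a, rfl⟩, h⟩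
    exact ⟨a, h⟩
  · rintro ⟨a, h⟩
    exact ⟨⟨_, a, rfl⟩, h⟩

theorem prodOn_pow_smul_frac (s : Finset (Fin r)) (m : M) (k : ℕ) :
    prodOn f s ^ k • frac f s m k = frac f s m 0 := by
  rw [smul_frac, ← frac_shift s m 0 k, zero_add]

theorem prodOn_pow_smul_injective (s : Finset (Fin r)) (k : ℕ) :
    Function.Injective fun z : LocAt f M s => prodOn f s ^ k • z :=
  IsLocalizedModule.smul_injective
    (LocalizedModule.mkLinearMap (Submonoid.powers (prodOn f s)) M)
    (⟨prodOn f s ^ k, pow_mem (Submonoid.mem_powers _) k⟩ : Submonoid.powers (prodOn f s))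

theorem prodOn_sdiff_mul {s t : Finset (Fin r)} (h : s ⊆ t) :
    prodOn f (t \ s) * prodOn f s = prodOn f t :=
  Finset.prod_sdiff h

theorem prodOn_singleton (j : Fin r) : prodOn f {j} = f j := Finset.prod_singleton _ _

theorem locMap_frac {s t : Finset (Fin r)} (h : s ⊆ t) (m : M) (k : ℕ) :
    locMap f M h (frac f s m k) = frac f t (prodOn f (t \ s) ^ k • m) k := by
  have h0 (m : M) : locMap f M h (frac f s m 0) = frac f t m 0 := by
    have : ∀ u : Finset (Fin r), frac f u m 0 = LocalizedModule.mk m 1 := fun u => by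
      rw [frac]; congr 1; exact Subtype.ext (pow_zero _)
    rw [this, this]
    exact LocalizedModule.lift_mk_one _ _ _ _
  -- Powers of f_t act injectively on M_{f_t}, so denominators may be cleared, which reduces to k =
  -- 0.
  apply prodOn_pow_smul_injective t k
  change prodOn f t ^ k • _ = prodOn f t ^ k • _
  have e : prodOn f t ^ k = prodOn f (t \ s) ^ k * prodOn f s ^ k := by
    rw [← mul_pow, prodOn_sdiff_mul h]
  conv_lhs => rw [e, mul_smul, ← map_smul, prodOn_pow_smul_frac, h0, smul_frac]
  rw [prodOn_pow_smul_frac]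

theorem locMap_locMap {s t u : Finset (Fin r)} (h : s ⊆ t) (h' : t ⊆ u) (z : LocAt f M s) :
    locMap f M h' (locMap f M h z) = locMap f M (h.trans h') z := by
  obtain ⟨m, k, rfl⟩ := exists_eq_frac z
  rw [locMap_frac, locMap_frac, locMap_frac, ← mul_smul, ← mul_pow]
  congr 3
  rw [prodOn, prodOn, prodOn, ← Finset.prod_union]
  · congr 1
    ext i
    have := @h i
    have := @h' i
    simp only [Finset.mem_union, Finset.mem_sdiff]
    tauto
  · rw [Finset.disjoint_left]
    intro i
    simp only [Finset.mem_sdiff]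
    tauto

theorem locMap_self {s : Finset (Fin r)} (h : s ⊆ s) (z : LocAt f M s) : locMap f M h z = z := by
  obtain ⟨m, k, rfl⟩ := exists_eq_frac z
  rw [locMap_frac]
  simp [prodOn]

variable (f) in
/-- The map `M_{f_s} → N_{f_s}` induced by a linear map `M → N`. -/
def locLin (φ : M →ₗ[S] N) (s : Finset (Fin r)) : LocAt f M s →ₗ[S] LocAt f N s :=
  IsLocalizedModule.map (Submonoid.powers (prodOn f s))
    (LocalizedModule.mkLinearMap _ M) (LocalizedModule.mkLinearMap _ N) φ

theorem locLin_frac (φ : M →ₗ[S] N) (s : Finset (Fin r)) (m : M) (k : ℕ) :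
    locLin f φ s (frac f s m k) = frac f s (φ m) k := by
  simp only [frac_eq_mk']
  exact IsLocalizedModule.map_mk' (Submonoid.powers (prodOn f s)) _ _ φ m _

theorem locLin_locMap (φ : M →ₗ[S] N) {s t : Finset (Fin r)} (h : s ⊆ t) (z : LocAt f M s) :
    locLin f φ t (locMap f M h z) = locMap f N h (locLin f φ s z) := by
  obtain ⟨m, k, rfl⟩ := exists_eq_frac z
  rw [locMap_frac, locLin_frac, locLin_frac, locMap_frac, map_smul]

/-- Inverting f_j in addition kills only f_j-torsion. Letting t lie anywhere between s and `insert j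
s` avoids rewriting index sets inside dependent types. -/
theorem exists_pow_smul_eq_zero_of_locMap_eq_zero {s t : Finset (Fin r)} {j : Fin r}
    (h : s ⊆ t) (ht : t ⊆ insert j s) {z : LocAt f M s} (hz : locMap f M h z = 0) :
    ∃ a : ℕ, f j ^ a • z = 0 := by
  have hz : locMap f M (Finset.subset_insert j s) z = 0 := by
    rw [← locMap_locMap h ht, hz, map_zero]
  by_cases hj : j ∈ s
  · refine ⟨0, ?_⟩
    have : ∀ (u : Finset (Fin r)) (hu : s ⊆ u), u = s → locMap f M hu z = 0 → z = 0 := by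
      rintro _ hu rfl h0
      rwa [locMap_self] at h0
    simpa using this _ _ (Finset.insert_eq_of_mem hj) hz
  obtain ⟨m, k, rfl⟩ := exists_eq_frac z
  rw [locMap_frac, frac_eq_zero_iff] at hz
  obtain ⟨a, ha⟩ := hz
  have e : insert j s \ s = {j} := by
    ext i
    simp only [Finset.mem_sdiff, Finset.mem_insert, Finset.mem_singleton]
    exact ⟨fun h => h.1.resolve_right h.2, fun h => ⟨Or.inl h, h ▸ hj⟩⟩
  rw [e, prodOn_singleton] at ha
  refine ⟨a + k, ?_⟩
  rw [smul_frac, frac_eq_zero_iff]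
  refine ⟨a, ?_⟩
  rw [prodOn, Finset.prod_insert hj, mul_pow] at ha
  rw [← ha, ← mul_smul, ← mul_smul, prodOn]
  congr 1
  ring

end Fractions

/-! ### Homogeneous fractions -/

section Pieces

variable {S : Type*} [CommRing S] {r : ℕ} {f : Fin r → S}
variable {M N : Type*} [AddCommGroup M] [Module S M] [AddCommGroup N] [Module S N]
variable {ℳ : ℕ → AddSubgroup M}

theorem prod_smul_mem (hf : ∀ i d, ∀ m ∈ ℳ d, f i • m ∈ ℳ (d + 1)) (s : Finset (Fin r)) {d : ℕ}
    {m : M} (hm : m ∈ ℳ d) : prodOn f s • m ∈ ℳ (d + s.card) := by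
  induction s using Finset.induction_on with
  | empty => simpa [prodOn] using hm
  | insert i s hi ih =>
    rw [prodOn, Finset.prod_insert hi, mul_smul, Finset.card_insert_of_notMem hi, ← add_assoc]
    exact hf _ _ _ ih

theorem pow_smul_mem {y : S} {e : ℕ} (hy : ∀ d, ∀ m ∈ ℳ d, y • m ∈ ℳ (d + e)) (a : ℕ) {d : ℕ}
    {m : M} (hm : m ∈ ℳ d) : y ^ a • m ∈ ℳ (d + a * e) := by
  induction a with
  | zero => simpa using hm
  | succ a ih =>
    rw [pow_succ', mul_smul, add_mul, one_mul, ← add_assoc]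
    exact hy _ _ ih

/-- Homogeneous fractions of equal degree are closed under addition over a common denominator. Zero
is listed apart because for s = ∅ and n < 0 there is no admissible numerator degree. -/
theorem eq_zero_or_eq_frac_of_mem_locPiece (hf : ∀ i d, ∀ m ∈ ℳ d, f i • m ∈ ℳ (d + 1))
    {s : Finset (Fin r)} {n : ℤ} {z : LocAt f M s} (hz : z ∈ locPiece f ℳ s n) :
    z = 0 ∨ ∃ (k d : ℕ) (m : M), m ∈ ℳ d ∧ (d : ℤ) = n + k * s.card ∧ z = frac f s m k := by
  induction hz using AddSubgroup.closure_induction with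
  | mem z hz => exact Or.inr hz
  | zero => exact Or.inl rfl
  | add x y _ _ hx hy =>
    obtain rfl | ⟨k, d, m, hm, hd, rfl⟩ := hx
    · rwa [zero_add]
    obtain rfl | ⟨k', d', m', hm', hd', rfl⟩ := hy
    · exact Or.inr ⟨k, d, m, hm, hd, add_zero _⟩
    have h1 := pow_smul_mem (fun d m hm => prod_smul_mem hf s (d := d) (m := m) hm) k' hm
    have h2 := pow_smul_mem (fun d m hm => prod_smul_mem hf s (d := d) (m := m) hm) k hm'
    have e : d' + k * s.card = d + k' * s.card := by zify; rw [hd, hd']; ring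
    rw [e] at h2
    refine Or.inr ⟨k + k', d + k' * s.card, _, add_mem h1 h2, by push_cast; rw [hd]; ring, ?_⟩
    rw [frac_add, frac_shift, add_comm k k', frac_shift]
  | neg x _ hx =>
    obtain rfl | ⟨k, d, m, hm, hd, rfl⟩ := hx
    · exact Or.inl neg_zero
    · exact Or.inr ⟨k, d, -m, neg_mem hm, hd, (frac_neg _ _ _).symm⟩

theorem frac_mem_locPiece {s : Finset (Fin r)} {n : ℤ} {k d : ℕ} {m : M} (hm : m ∈ ℳ d)
    (hd : (d : ℤ) = n + k * s.card) : frac f s m k ∈ locPiece f ℳ s n :=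
  AddSubgroup.subset_closure ⟨k, d, m, hm, hd, rfl⟩

theorem smul_mem_locPiece (hf : ∀ i d, ∀ m ∈ ℳ d, f i • m ∈ ℳ (d + 1)) {s : Finset (Fin r)}
    {y : S} {e : ℕ} (hy : ∀ d, ∀ m ∈ ℳ d, y • m ∈ ℳ (d + e)) {n : ℤ} {z : LocAt f M s}
    (hz : z ∈ locPiece f ℳ s n) : y • z ∈ locPiece f ℳ s (n + e) := by
  obtain rfl | ⟨k, d, m, hm, hd, rfl⟩ := eq_zero_or_eq_frac_of_mem_locPiece hf hz
  · rw [smul_zero]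
    exact zero_mem _
  · rw [smul_frac]
    exact frac_mem_locPiece (hy _ _ hm) (by push_cast; rw [hd]; ring)

theorem locMap_mem_locPiece (hf : ∀ i d, ∀ m ∈ ℳ d, f i • m ∈ ℳ (d + 1)) {s t : Finset (Fin r)}
    (h : s ⊆ t) {n : ℤ} {z : LocAt f M s} (hz : z ∈ locPiece f ℳ s n) :
    locMap f M h z ∈ locPiece f ℳ t n := by
  obtain rfl | ⟨k, d, m, hm, hd, rfl⟩ := eq_zero_or_eq_frac_of_mem_locPiece hf hz
  · rw [map_zero]
    exact zero_mem _
  · rw [locMap_frac]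
    refine frac_mem_locPiece
      (pow_smul_mem (fun d m hm => prod_smul_mem hf (t \ s) (d := d) (m := m) hm) k hm) ?_
    have := Finset.card_sdiff_add_card_eq_card h
    push_cast
    rw [hd, ← this]
    push_cast
    ring

/-- If the denominator is (f_s f_j)^k, then f_j^a with a ≥ k cancels its f_j-part. The "eventually"
form yields one exponent for finitely many fractions at once. -/
theorem eventually_exists_locMap_eq (hf : ∀ i d, ∀ m ∈ ℳ d, f i • m ∈ ℳ (d + 1))
    {s : Finset (Fin r)} {j : Fin r} (hj : j ∉ s) {n : ℤ} {z : LocAt f M (insert j s)}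
    (hz : z ∈ locPiece f ℳ (insert j s) n) :
    ∀ᶠ a : ℕ in Filter.atTop, ∃ w ∈ locPiece f ℳ s (n + a),
      locMap f M (Finset.subset_insert j s) w = f j ^ a • z := by
  obtain rfl | ⟨k, d, m, hm, hd, rfl⟩ := eq_zero_or_eq_frac_of_mem_locPiece hf hz
  · exact Filter.Eventually.of_forall fun a => ⟨0, zero_mem _, by simp⟩
  · filter_upwards [Filter.eventually_ge_atTop k] with a ha
    refine ⟨f j ^ (a - k) • frac f s m k, ?_, ?_⟩
    · rw [smul_frac]
      refine frac_mem_locPiece (pow_smul_mem (hf j) (a - k) hm) ?_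
      rw [Finset.card_insert_of_notMem hj] at hd
      push_cast [Nat.cast_sub ha] at hd ⊢
      rw [hd]
      ring
    · have e : insert j s \ s = {j} := by
        ext i
        simp only [Finset.mem_sdiff, Finset.mem_insert, Finset.mem_singleton]
        exact ⟨fun h => h.1.resolve_right h.2, fun h => ⟨Or.inl h, h ▸ hj⟩⟩
      rw [map_smul, locMap_frac, e, prodOn_singleton, ← smul_frac, ← mul_smul, ← pow_add,
        Nat.sub_add_cancel ha]

end Pieces

/-! ### The Čech complex -/

section Complex

variable {S : Type*} [CommRing S] {r : ℕ} {f : Fin r → S}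
variable {M N : Type*} [AddCommGroup M] [Module S M] [AddCommGroup N] [Module S N]
variable {ℳ : ℕ → AddSubgroup M}

/-- The components of a cochain, extended by zero to all index sets. -/
def component {p : ℕ} (c : CechCochain f M p) (s : Finset (Fin r)) : LocAt f M s :=
  if h : s.card = p then c ⟨s, h⟩ else 0

theorem component_eq {p : ℕ} (c : CechCochain f M p) (s : Finset (Fin r)) (h : s.card = p) :
    component c s = c ⟨s, h⟩ := dif_pos h

variable (S) in
/-- The sign attached to `i` in `t` in the Čech differential. -/
def sgn (i : Fin r) (t : Finset (Fin r)) : S := (-1) ^ (t.filter (· < i)).card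

theorem sgn_mul_self (i : Fin r) (t : Finset (Fin r)) : sgn S i t * sgn S i t = 1 := by
  rw [sgn, ← mul_pow]
  norm_num

/-- Erasing the smaller index shifts the position of the larger by one, while erasing the larger
does not move the smaller. This is the sign rule behind d² = 0. -/
theorem sgn_mul_sgn_erase {i j : Fin r} {t : Finset (Fin r)} (hi : i ∈ t) (hj : j ∈ t)
    (hij : i ≠ j) : sgn S i t * sgn S j (t.erase i) = - (sgn S j t * sgn S i (t.erase j)) := by
  wlog h : i < j generalizing i j with H
  · rw [H hj hi hij.symm (lt_of_le_of_ne (not_lt.mp h) hij.symm), neg_neg]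
  have h1 : (t.erase j).filter (· < i) = t.filter (· < i) := by
    ext k
    simp only [Finset.mem_filter, Finset.mem_erase]
    exact ⟨fun hk => ⟨hk.1.2, hk.2⟩, fun hk => ⟨⟨(hk.2.trans h).ne, hk.1⟩, hk.2⟩⟩
  have h2 : ((t.erase i).filter (· < j)).card + 1 = (t.filter (· < j)).card := by
    rw [Finset.filter_erase, Finset.card_erase_add_one]
    simp [hi, h]
  rw [sgn, sgn, sgn, sgn, h1, ← h2, pow_succ]
  ring

theorem sgn_smul_mem {i : Fin r} {t s : Finset (Fin r)} {H : AddSubgroup (LocAt f M s)}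
    {z : LocAt f M s} (hz : z ∈ H) : sgn S i t • z ∈ H := by
  obtain h | h := neg_one_pow_eq_or S (t.filter (· < i)).card
  · rwa [sgn, h, one_smul]
  · rw [sgn, h, neg_smul, one_smul]
    exact neg_mem hz

theorem cechD_apply {p : ℕ} (c : CechCochain f M p)
    (t : {t : Finset (Fin r) // t.card = p + 1}) :
    cechD f M p c t = ∑ i ∈ t.1,
      sgn S i t.1 • locMap f M (Finset.erase_subset i t.1) (component c (t.1.erase i)) := by
  rw [← Finset.sum_attach]
  simp only [cechD, LinearMap.pi_apply, LinearMap.sum_apply]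
  refine Finset.sum_congr rfl fun i _ => ?_
  rw [component_eq _ _ (by rw [Finset.card_erase_of_mem i.2, t.2]; rfl),
    ← Int.cast_smul_eq_zsmul S, sgn]
  push_cast
  rfl

theorem component_congr {p : ℕ} (c : CechCochain f M p) {s s' t : Finset (Fin r)} (e : s = s')
    (h : s ⊆ t) (h' : s' ⊆ t) :
    locMap f M h (component c s) = locMap f M h' (component c s') := by
  subst e
  rfl

theorem cechD_cechD {p : ℕ} (c : CechCochain f M p) : cechD f M (p + 1) (cechD f M p c) = 0 := by
  funext t
  rw [cechD_apply, Pi.zero_apply]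
  have key : ∀ i ∈ t.1, sgn S i t.1 • locMap f M (Finset.erase_subset i t.1)
      (component (cechD f M p c) (t.1.erase i)) = ∑ j ∈ t.1.erase i,
        (sgn S i t.1 * sgn S j (t.1.erase i)) • locMap f M
          ((Finset.erase_subset j _).trans (Finset.erase_subset i t.1))
          (component c ((t.1.erase i).erase j)) := by
    intro i hi
    rw [component_eq _ _ (by rw [Finset.card_erase_of_mem hi, t.2]; rfl), cechD_apply, map_sum,
      Finset.smul_sum]
    refine Finset.sum_congr rfl fun j _ => ?_
    rw [map_smul, mul_smul, locMap_locMap]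
  rw [Finset.sum_congr rfl key, Finset.sum_sigma']
  -- Erasing i then j cancels against erasing j then i.
  refine Finset.sum_involution (fun x _ => ⟨x.2, x.1⟩) ?_ ?_ ?_ ?_
  · rintro ⟨i, j⟩ hx
    simp only [Finset.mem_sigma, Finset.mem_erase] at hx
    dsimp only
    rw [component_congr c Finset.erase_right_comm _
      ((Finset.erase_subset i _).trans (Finset.erase_subset j t.1)),
      sgn_mul_sgn_erase hx.1 hx.2.2 (Ne.symm hx.2.1), neg_smul, neg_add_cancel]
  · rintro ⟨i, j⟩ hx _ h
    simp only [Finset.mem_sigma, Finset.mem_erase] at hx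
    rw [Sigma.mk.injEq] at h
    exact hx.2.1 h.1
  · rintro ⟨i, j⟩ hx
    simp only [Finset.mem_sigma, Finset.mem_erase] at hx ⊢
    exact ⟨hx.2.2, hx.2.1.symm, hx.1⟩
  · intros
    rfl

theorem mem_cochainPiece {p : ℕ} {n : ℤ} {c : CechCochain f M p} :
    c ∈ cochainPiece f ℳ p n ↔ ∀ s, c s ∈ locPiece f ℳ s.1 n := by
  simp [cochainPiece, AddSubgroup.mem_pi]

theorem component_mem_locPiece {p : ℕ} {n : ℤ} {c : CechCochain f M p}
    (hc : c ∈ cochainPiece f ℳ p n) (s : Finset (Fin r)) :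
    component c s ∈ locPiece f ℳ s n := by
  by_cases h : s.card = p
  · rw [component_eq c s h]
    exact mem_cochainPiece.mp hc ⟨s, h⟩
  · rw [component, dif_neg h]
    exact zero_mem _

theorem cechD_mem_cochainPiece (hf : ∀ i d, ∀ m ∈ ℳ d, f i • m ∈ ℳ (d + 1)) {p : ℕ} {n : ℤ}
    {c : CechCochain f M p} (hc : c ∈ cochainPiece f ℳ p n) :
    cechD f M p c ∈ cochainPiece f ℳ (p + 1) n := by
  rw [mem_cochainPiece]
  intro t
  rw [cechD_apply]
  exact sum_mem fun i _ => sgn_smul_mem (locMap_mem_locPiece hf _ (component_mem_locPiece hc _))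

theorem smul_mem_cochainPiece (hf : ∀ i d, ∀ m ∈ ℳ d, f i • m ∈ ℳ (d + 1)) {p : ℕ}
    {y : S} {e : ℕ} (hy : ∀ d, ∀ m ∈ ℳ d, y • m ∈ ℳ (d + e)) {n : ℤ} {c : CechCochain f M p}
    (hc : c ∈ cochainPiece f ℳ p n) : y • c ∈ cochainPiece f ℳ p (n + e) :=
  mem_cochainPiece.mpr fun s => smul_mem_locPiece hf hy (mem_cochainPiece.mp hc s)

theorem mem_cocyclePiece {p : ℕ} {n : ℤ} {c : CechCochain f M p} :
    c ∈ cocyclePiece f ℳ p n ↔ c ∈ cochainPiece f ℳ p n ∧ cechD f M p c = 0 := Iff.rfl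

theorem mem_coboundaryPiece_succ {p : ℕ} {n : ℤ} {c : CechCochain f M (p + 1)} :
    c ∈ coboundaryPiece f ℳ (p + 1) n ↔ ∃ b ∈ cochainPiece f ℳ p n, cechD f M p b = c := Iff.rfl

theorem smul_mem_coboundaryPiece (hf : ∀ i d, ∀ m ∈ ℳ d, f i • m ∈ ℳ (d + 1)) {p : ℕ}
    {y : S} {e : ℕ} (hy : ∀ d, ∀ m ∈ ℳ d, y • m ∈ ℳ (d + e)) {n : ℤ} {c : CechCochain f M p}
    (hc : c ∈ coboundaryPiece f ℳ p n) : y • c ∈ coboundaryPiece f ℳ p (n + e) := by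
  cases p with
  | zero =>
    rw [show c = 0 from hc, smul_zero]
    exact zero_mem _
  | succ p =>
    obtain ⟨b, hb, rfl⟩ := hc
    exact ⟨y • b, smul_mem_cochainPiece hf hy hb, (cechD f M p).map_smul y b⟩

end Complex

end FiberConeReg

end

noncomputable section

namespace FiberConeReg

/-! ### Čech cohomology is torsion -/

section Torsion

variable {S : Type*} [CommRing S] {r : ℕ} {f : Fin r → S}
variable {M : Type*} [AddCommGroup M] [Module S M]
variable {ℳ : ℕ → AddSubgroup M}

theorem sgn_smul_eq_zero {i : Fin r} {t s : Finset (Fin r)} {z : LocAt f M s}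
    (h : sgn S i t • z = 0) : z = 0 := by
  rw [← one_smul S z, ← sgn_mul_self i t, mul_smul, h, smul_zero]

/-- The component of the cocycle condition at {j} says that c dies in M_{f_j}. -/
theorem exists_pow_smul_eq_zero_of_cocycle {j : Fin r} {c : CechCochain f M 0}
    (hc : cechD f M 0 c = 0) : ∃ a : ℕ, f j ^ a • c = 0 := by
  have hd := congrFun hc ⟨{j}, Finset.card_singleton j⟩
  rw [cechD_apply] at hd
  simp only [Finset.sum_singleton, Pi.zero_apply] at hd
  obtain ⟨a, ha⟩ := exists_pow_smul_eq_zero_of_locMap_eq_zero (j := j)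
    (Finset.erase_subset j {j}) (by simp) (sgn_smul_eq_zero hd)
  refine ⟨a, funext fun s => ?_⟩
  have : ∀ s : Finset (Fin r), s = ({j} : Finset (Fin r)).erase j →
      f j ^ a • component c s = 0 := by
    rintro _ rfl
    exact ha
  have := this s.1 (by rw [Finset.card_eq_zero.mp s.2]; simp)
  rwa [component_eq c s.1 s.2] at this

/-- If `w s` lifts `f_j ^ a • c` along `M_{f_s} → M_{f_s f_j}`, the cochain with components
`± w s` bounds `f_j ^ a • c` up to `f_j`-torsion. -/
theorem exists_pow_smul_sub_cechD_eq_zero {p : ℕ} {j : Fin r} {a : ℕ}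
    {c : CechCochain f M (p + 1)} (hc : cechD f M (p + 1) c = 0) {b : CechCochain f M p}
    (hb : ∀ s : Finset (Fin r), s.card = p → j ∉ s →
      locMap f M (Finset.subset_insert j s) (component b s) =
        sgn S j (insert j s) • f j ^ a • component c (insert j s))
    (hb' : ∀ s : Finset (Fin r), j ∈ s → component b s = 0)
    (t : {t : Finset (Fin r) // t.card = p + 1}) :
    ∃ k : ℕ, f j ^ k • (f j ^ a • c t - cechD f M p b t) = 0 := by
  have hcard : ∀ i ∈ t.1, (t.1.erase i).card = p := fun i hi => by
    rw [Finset.card_erase_of_mem hi, t.2]; rfl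
  have hbt : ∀ (s u : Finset (Fin r)) (h : s ⊆ u) (h' : insert j s ⊆ u), s.card = p → j ∉ s →
      locMap f M h (component b s) =
        sgn S j (insert j s) • f j ^ a • locMap f M h' (component c (insert j s)) := by
    intro s u h h' hs hjs
    rw [← locMap_locMap (Finset.subset_insert j s) h', hb s hs hjs, map_smul, map_smul]
  -- If j ∈ t, only the term erasing j survives in d b, and the identity is exact. Otherwise it
  -- holds after inverting f_j: the cocycle condition at `insert j t` expresses c_t there through
  -- the other components.
  by_cases hj : j ∈ t.1
  · refine ⟨0, ?_⟩
    have e := Finset.insert_erase hj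
    rw [cechD_apply, Finset.sum_eq_single j, hbt _ _ _ e.le (hcard j hj) (by simp),
      component_congr c e _ subset_rfl, e, locMap_self, component_eq c t.1 t.2, ← mul_smul,
      sgn_mul_self, one_smul, sub_self, smul_zero]
    · intro i hi hij
      rw [hb' _ (Finset.mem_erase.mpr ⟨hij.symm, hj⟩), map_zero, smul_zero]
    · exact fun h => (h hj).elim
  · refine exists_pow_smul_eq_zero_of_locMap_eq_zero (Finset.subset_insert j t.1) subset_rfl ?_
    have hT : (insert j t.1).card = p + 1 + 1 := by rw [Finset.card_insert_of_notMem hj, t.2]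
    have hd := congrFun hc ⟨insert j t.1, hT⟩
    rw [cechD_apply] at hd
    simp only [Pi.zero_apply] at hd
    rw [Finset.sum_insert hj, component_congr c (Finset.erase_insert hj) _
      (Finset.subset_insert j t.1), component_eq c t.1 t.2] at hd
    have hd' := congrArg (sgn S j (insert j t.1) • ·) hd
    simp only [smul_add, smul_zero, ← mul_smul, sgn_mul_self, one_smul, Finset.smul_sum] at hd'
    rw [map_sub, map_smul, eq_neg_of_add_eq_zero_left hd', cechD_apply, map_sum, smul_neg,
      Finset.smul_sum, sub_eq_zero, ← Finset.sum_neg_distrib]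
    refine Finset.sum_congr rfl fun i hi => ?_
    have hij : i ≠ j := fun h => hj (h ▸ hi)
    have e : insert j (t.1.erase i) = (insert j t.1).erase i :=
      (Finset.erase_insert_of_ne hij.symm).symm
    rw [map_smul, locMap_locMap, hbt _ _ _ (e ▸ Finset.erase_subset _ _) (hcard i hi)
      (fun h => hj (Finset.mem_of_mem_erase h)), component_congr c e _ (Finset.erase_subset _ _), e]
    have hs := sgn_mul_sgn_erase (S := S) (Finset.mem_insert_self j t.1)
      (Finset.mem_insert_of_mem hi) hij.symm
    rw [Finset.erase_insert hj] at hs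
    rw [← mul_smul, ← mul_smul, ← mul_smul, ← neg_smul]
    congr 1
    have h1 := sgn_mul_self (S := S) j (insert j t.1)
    have h2 := sgn_mul_self (S := S) j ((insert j t.1).erase i)
    linear_combination (-f j ^ a * sgn S j (insert j t.1) * sgn S j ((insert j t.1).erase i)) * hs
      + f j ^ a * sgn S i t.1 * sgn S j ((insert j t.1).erase i) * h1
      + f j ^ a * sgn S j (insert j t.1) * sgn S i (insert j t.1) * h2

/-- After inverting f_j the Čech complex is contractible. The contracting homotopy is used here with
denominators cleared, at the cost of a power of f_j. -/
theorem exists_pow_smul_mem_coboundaryPiece (hf : ∀ i d, ∀ m ∈ ℳ d, f i • m ∈ ℳ (d + 1)) {p : ℕ}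
    {n : ℤ} {c : CechCochain f M p} (hc : c ∈ cocyclePiece f ℳ p n) (j : Fin r) :
    ∃ a : ℕ, f j ^ a • c ∈ coboundaryPiece f ℳ p (n + a) := by
  have hpow (a : ℕ) : ∀ d, ∀ m ∈ ℳ d, f j ^ a • m ∈ ℳ (d + a) := fun d m hm => by
    simpa using pow_smul_mem (hf j) a hm
  cases p with
  | zero =>
    obtain ⟨a, ha⟩ := exists_pow_smul_eq_zero_of_cocycle (j := j) hc.2
    exact ⟨a, ha ▸ zero_mem _⟩
  | succ p =>
    -- A single a serves all of the finitely many s.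
    have h1 : ∀ᶠ a : ℕ in Filter.atTop, ∀ s : {s : Finset (Fin r) // s.card = p}, j ∉ s.1 →
        ∃ w ∈ locPiece f ℳ s.1 (n + a),
          locMap f M (Finset.subset_insert j s.1) w = f j ^ a • component c (insert j s.1) := by
      rw [Filter.eventually_all]
      intro s
      rw [Filter.eventually_imp_distrib_left]
      exact fun hj => eventually_exists_locMap_eq hf hj (component_mem_locPiece hc.1 _)
    obtain ⟨a, ha⟩ := h1.exists
    choose w hw hw' using ha
    classical
    let b : CechCochain f M p := fun s =>
      if h : j ∈ s.1 then 0 else sgn S j (insert j s.1) • w s h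
    have hbp : b ∈ cochainPiece f ℳ p (n + a) := by
      rw [mem_cochainPiece]
      intro s
      by_cases h : j ∈ s.1
      · simp only [b, dif_pos h]
        exact zero_mem _
      · simp only [b, dif_neg h]
        exact sgn_smul_mem (hw s h)
    have h2 := exists_pow_smul_sub_cechD_eq_zero (a := a) hc.2 (b := b) (j := j)
      (fun s hs h => by
        rw [component_eq b s hs]
        simp only [b, dif_neg h]
        rw [map_smul, hw' ⟨s, hs⟩ h])
      (fun s h => by
        by_cases hs : s.card = p
        · rw [component_eq b s hs]
          simp only [b, dif_pos h]
        · rw [component, dif_neg hs])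
    choose k hk using h2
    -- The largest of the exponents k t kills the f_j-torsion discrepancy in every component.
    have hK : ∀ t, k t ≤ Finset.univ.sup k := fun t => Finset.le_sup (Finset.mem_univ t)
    refine ⟨a + Finset.univ.sup k, f j ^ Finset.univ.sup k • b, ?_, ?_⟩
    · push_cast
      rw [← add_assoc]
      exact smul_mem_cochainPiece hf (hpow _) hbp
    · change cechD f M p _ = _
      rw [map_smul]
      funext t
      have h3 : f j ^ Finset.univ.sup k • (f j ^ a • c t - cechD f M p b t) = 0 := by
        rw [← Nat.sub_add_cancel (hK t), pow_add, mul_smul, hk, smul_zero]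
      rw [smul_sub, sub_eq_zero, ← mul_smul, ← pow_add, add_comm _ a] at h3
      exact h3.symm

end Torsion

/-! ### Hyperplane sections -/

section Section

variable {S : Type*} [CommRing S] {r : ℕ} {f : Fin r → S}
variable {M N : Type*} [AddCommGroup M] [Module S M] [AddCommGroup N] [Module S N]
variable {ℳ : ℕ → AddSubgroup M} {𝒩 : ℕ → AddSubgroup N}

variable (f ℳ) in
/-- The degree `n` part of the `p`-th Čech cohomology vanishes. -/
def Vanishes (p : ℕ) (n : ℤ) : Prop := cocyclePiece f ℳ p n ≤ coboundaryPiece f ℳ p n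

theorem nontrivial_cechCohomology_iff {p : ℕ} {n : ℤ} :
    Nontrivial (CechCohomology f ℳ p n) ↔ ¬ Vanishes f ℳ p n := by
  rw [Vanishes, ← not_subsingleton_iff_nontrivial, QuotientAddGroup.subsingleton_iff,
    AddSubgroup.addSubgroupOf_eq_top]

variable (f) in
/-- The map of Čech cochains induced by a linear map. -/
def cochainMap (φ : M →ₗ[S] N) {p : ℕ} (c : CechCochain f M p) : CechCochain f N p :=
  fun s => locLin f φ s.1 (c s)

theorem cochainMap_cechD (φ : M →ₗ[S] N) {p : ℕ} (c : CechCochain f M p) :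
    cochainMap f φ (cechD f M p c) = cechD f N p (cochainMap f φ c) := by
  funext t
  rw [cochainMap, cechD_apply, cechD_apply, map_sum]
  refine Finset.sum_congr rfl fun i hi => ?_
  have h : (t.1.erase i).card = p := by rw [Finset.card_erase_of_mem hi, t.2]; rfl
  rw [map_smul, locLin_locMap, component_eq _ _ h, component_eq _ _ h]
  rfl

theorem cochainMap_sub (φ : M →ₗ[S] N) {p : ℕ} (b c : CechCochain f M p) :
    cochainMap f φ (b - c) = cochainMap f φ b - cochainMap f φ c :=
  funext fun _ => map_sub _ _ _

theorem cochainMap_zero (φ : M →ₗ[S] N) {p : ℕ} : cochainMap f φ (0 : CechCochain f M p) = 0 :=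
  funext fun _ => map_zero _

variable (f) in
/-- `φ : M → N` is the quotient map by a linear form `x` that acts on `M` with kernel
torsion with respect to the system `f`, everything being graded. -/
structure IsLinearSection (x : S) (ℳ : ℕ → AddSubgroup M) (φ : M →ₗ[S] N)
    (𝒩 : ℕ → AddSubgroup N) : Prop where
  gen_smul_mem : ∀ i d, ∀ m ∈ ℳ d, f i • m ∈ ℳ (d + 1)
  smul_mem : ∀ d, ∀ m ∈ ℳ d, x • m ∈ ℳ (d + 1)
  map_eq : ∀ d, 𝒩 d = (ℳ d).map φ.toAddMonoidHom
  map_smul_eq_zero : ∀ m, φ (x • m) = 0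
  -- Degree 0 is separate: with pieces indexed by ℕ there is no degree -1 from which to multiply by
  -- x.
  eq_zero_of_map_eq_zero : ∀ m ∈ ℳ 0, φ m = 0 → m = 0
  exists_of_map_eq_zero : ∀ d, ∀ m ∈ ℳ (d + 1), φ m = 0 → ∃ m' ∈ ℳ d, x • m' = m
  torsion : ∀ d, ∀ m ∈ ℳ d, x • m = 0 → ∀ j, ∃ a : ℕ, f j ^ a • m = 0

namespace IsLinearSection

variable {x : S} {φ : M →ₗ[S] N}

theorem gen_smul_mem' (H : IsLinearSection f x ℳ φ 𝒩) :
    ∀ i d, ∀ m ∈ 𝒩 d, f i • m ∈ 𝒩 (d + 1) := by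
  intro i d m hm
  rw [H.map_eq] at hm ⊢
  obtain ⟨m, hm, rfl⟩ := hm
  exact ⟨f i • m, H.gen_smul_mem i d m hm, φ.map_smul _ _⟩

theorem exists_locLin_eq (H : IsLinearSection f x ℳ φ 𝒩) {s : Finset (Fin r)} {n : ℤ}
    {z : LocAt f N s} (hz : z ∈ locPiece f 𝒩 s n) :
    ∃ w ∈ locPiece f ℳ s n, locLin f φ s w = z := by
  obtain rfl | ⟨k, d, m, hm, hd, rfl⟩ := eq_zero_or_eq_frac_of_mem_locPiece H.gen_smul_mem' hz
  · exact ⟨0, zero_mem _, map_zero _⟩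
  · rw [H.map_eq] at hm
    obtain ⟨m, hm, rfl⟩ := hm
    exact ⟨frac f s m k, frac_mem_locPiece hm hd, locLin_frac _ _ _ _⟩

theorem locLin_mem (H : IsLinearSection f x ℳ φ 𝒩) {s : Finset (Fin r)} {n : ℤ}
    {z : LocAt f M s} (hz : z ∈ locPiece f ℳ s n) : locLin f φ s z ∈ locPiece f 𝒩 s n := by
  obtain rfl | ⟨k, d, m, hm, hd, rfl⟩ := eq_zero_or_eq_frac_of_mem_locPiece H.gen_smul_mem hz
  · rw [map_zero]
    exact zero_mem _
  · rw [locLin_frac]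
    exact frac_mem_locPiece (by rw [H.map_eq]; exact ⟨m, hm, rfl⟩) hd

/-- Exactness in the middle survives localisation: after multiplication by a power of f_s the
numerator itself lies in the kernel of φ. -/
theorem exists_smul_eq (H : IsLinearSection f x ℳ φ 𝒩) {s : Finset (Fin r)} {n : ℤ}
    {z : LocAt f M s} (hz : z ∈ locPiece f ℳ s n) (h0 : locLin f φ s z = 0) :
    ∃ w ∈ locPiece f ℳ s (n - 1), x • w = z := by
  obtain rfl | ⟨k, d, m, hm, hd, rfl⟩ := eq_zero_or_eq_frac_of_mem_locPiece H.gen_smul_mem hz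
  · exact ⟨0, zero_mem _, smul_zero _⟩
  · rw [locLin_frac, frac_eq_zero_iff] at h0
    obtain ⟨a, ha⟩ := h0
    rw [← map_smul] at ha
    have hm' := pow_smul_mem
      (fun d m hm => prod_smul_mem H.gen_smul_mem s (d := d) (m := m) hm) a hm
    rw [← frac_shift s m k a]
    rcases hD : d + a * s.card with _ | e
    · rw [hD] at hm'
      rw [H.eq_zero_of_map_eq_zero _ hm' ha, frac_zero]
      exact ⟨0, zero_mem _, smul_zero _⟩
    · rw [hD] at hm'
      obtain ⟨m', hm'', h⟩ := H.exists_of_map_eq_zero e _ hm' ha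
      refine ⟨frac f s m' (k + a), frac_mem_locPiece hm'' ?_, by rw [smul_frac, h]⟩
      have : ((d + a * s.card : ℕ) : ℤ) = e + 1 := by rw [hD]; rfl
      push_cast at this ⊢
      linarith

/-- The kernel of x is f_j-torsion, hence disappears once some f_j is inverted. So x is injective on
cochains of positive cohomological degree, and only p = 0 needs separate care. -/
theorem eq_zero_of_smul_eq_zero (H : IsLinearSection f x ℳ φ 𝒩) {s : Finset (Fin r)}
    (hs : s.Nonempty) {n : ℤ} {z : LocAt f M s} (hz : z ∈ locPiece f ℳ s n) (h0 : x • z = 0) :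
    z = 0 := by
  obtain rfl | ⟨k, d, m, hm, hd, rfl⟩ := eq_zero_or_eq_frac_of_mem_locPiece H.gen_smul_mem hz
  · rfl
  · rw [smul_frac, frac_eq_zero_iff] at h0
    obtain ⟨a, ha⟩ := h0
    obtain ⟨j, hj⟩ := hs
    rw [smul_comm] at ha
    obtain ⟨b, hb⟩ := H.torsion _ _ (pow_smul_mem
      (fun d m hm => prod_smul_mem H.gen_smul_mem s (d := d) (m := m) hm) a hm) ha j
    rw [frac_eq_zero_iff]
    refine ⟨b + a, ?_⟩
    rw [pow_add, mul_smul]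
    nth_rw 1 [prodOn]
    rw [← Finset.prod_erase_mul s f hj, mul_pow, mul_smul, hb, smul_zero]

theorem exists_cochainMap_eq (H : IsLinearSection f x ℳ φ 𝒩) {p : ℕ} {n : ℤ}
    {c : CechCochain f N p} (hc : c ∈ cochainPiece f 𝒩 p n) :
    ∃ b ∈ cochainPiece f ℳ p n, cochainMap f φ b = c := by
  choose b hb hb' using fun s => H.exists_locLin_eq (mem_cochainPiece.mp hc s)
  exact ⟨b, mem_cochainPiece.mpr hb, funext hb'⟩

theorem cochainMap_mem (H : IsLinearSection f x ℳ φ 𝒩) {p : ℕ} {n : ℤ}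
    {c : CechCochain f M p} (hc : c ∈ cochainPiece f ℳ p n) :
    cochainMap f φ c ∈ cochainPiece f 𝒩 p n :=
  mem_cochainPiece.mpr fun s => H.locLin_mem (mem_cochainPiece.mp hc s)

theorem exists_smul_eq_of_cochainMap_eq_zero (H : IsLinearSection f x ℳ φ 𝒩) {p : ℕ} {n : ℤ}
    {c : CechCochain f M p} (hc : c ∈ cochainPiece f ℳ p n) (h0 : cochainMap f φ c = 0) :
    ∃ b ∈ cochainPiece f ℳ p (n - 1), x • b = c := by
  choose b hb hb' using fun s => H.exists_smul_eq (mem_cochainPiece.mp hc s) (congrFun h0 s)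
  exact ⟨b, mem_cochainPiece.mpr hb, funext hb'⟩

theorem cochain_eq_zero_of_smul_eq_zero (H : IsLinearSection f x ℳ φ 𝒩) {p : ℕ} {n : ℤ}
    {c : CechCochain f M (p + 1)} (hc : c ∈ cochainPiece f ℳ (p + 1) n) (h0 : x • c = 0) :
    c = 0 :=
  funext fun s => H.eq_zero_of_smul_eq_zero (Finset.card_pos.mp (by rw [s.2]; omega))
    (mem_cochainPiece.mp hc s) (congrFun h0 s)

theorem cochainMap_smul_eq_zero (H : IsLinearSection f x ℳ φ 𝒩) {p : ℕ}
    (c : CechCochain f M p) : cochainMap f φ (x • c) = 0 := by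
  funext s
  obtain ⟨m, k, h⟩ := exists_eq_frac (c s)
  change locLin f φ s.1 (x • c s) = 0
  rw [h, smul_frac, locLin_frac, H.map_smul_eq_zero, frac_zero]

theorem smul_mem_cochainPiece (H : IsLinearSection f x ℳ φ 𝒩) {p : ℕ} {n : ℤ}
    {c : CechCochain f M p} (hc : c ∈ cochainPiece f ℳ p n) :
    x • c ∈ cochainPiece f ℳ p (n + 1) := by
  simpa using FiberConeReg.smul_mem_cochainPiece H.gen_smul_mem (e := 1) H.smul_mem hc

/-- Vanishing of cohomology descends to a hyperplane section. -/
theorem vanishes_section (H : IsLinearSection f x ℳ φ 𝒩) {p : ℕ} {n : ℤ}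
    (h : Vanishes f ℳ p n) (h' : Vanishes f ℳ (p + 1) (n - 1)) : Vanishes f 𝒩 p n := by
  rintro c ⟨hc, hc0⟩
  obtain ⟨b, hb, rfl⟩ := H.exists_cochainMap_eq hc
  change cechD f N p _ = 0 at hc0
  rw [← cochainMap_cechD] at hc0
  -- The cocycle e represents the connecting homomorphism applied to the class of c. It bounds, so
  -- the lift b can be corrected to a cocycle.
  obtain ⟨e, he, hbe⟩ := H.exists_smul_eq_of_cochainMap_eq_zero
    (cechD_mem_cochainPiece H.gen_smul_mem hb) hc0
  have hde : cechD f M (p + 1) e = 0 := by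
    refine H.cochain_eq_zero_of_smul_eq_zero (cechD_mem_cochainPiece H.gen_smul_mem he) ?_
    rw [← map_smul, hbe, cechD_cechD]
  obtain ⟨g, hg, rfl⟩ := mem_coboundaryPiece_succ.mp (h' (mem_cocyclePiece.mpr ⟨he, hde⟩))
  have hxg : x • g ∈ cochainPiece f ℳ p n := by
    simpa using H.smul_mem_cochainPiece hg
  have hcyc : b - x • g ∈ cocyclePiece f ℳ p n :=
    mem_cocyclePiece.mpr ⟨sub_mem hb hxg, by rw [map_sub, map_smul, hbe, sub_self]⟩
  have e : cochainMap f φ b = cochainMap f φ (b - x • g) := by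
    rw [cochainMap_sub, H.cochainMap_smul_eq_zero, sub_zero]
  rw [e]
  have := h hcyc
  cases p with
  | zero =>
    rw [show b - x • g = 0 from this, cochainMap_zero]
    exact zero_mem _
  | succ p =>
    obtain ⟨u, hu, hu'⟩ := mem_coboundaryPiece_succ.mp this
    exact mem_coboundaryPiece_succ.mpr
      ⟨cochainMap f φ u, H.cochainMap_mem hu, by rw [← cochainMap_cechD, hu']⟩

/-- If the cohomology of a hyperplane section vanishes, multiplication by the linear form is
injective on cohomology. -/
theorem mem_coboundaryPiece_of_smul_mem (H : IsLinearSection f x ℳ φ 𝒩) {p : ℕ} {n : ℤ}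
    (h : Vanishes f 𝒩 p (n + 1)) {c : CechCochain f M (p + 1)}
    (hc : c ∈ cochainPiece f ℳ (p + 1) n)
    (hxc : x • c ∈ coboundaryPiece f ℳ (p + 1) (n + 1)) :
    c ∈ coboundaryPiece f ℳ (p + 1) n := by
  obtain ⟨b, hb, hbc⟩ := mem_coboundaryPiece_succ.mp hxc
  have hcyc : cochainMap f φ b ∈ cocyclePiece f 𝒩 p (n + 1) := by
    refine mem_cocyclePiece.mpr ⟨H.cochainMap_mem hb, ?_⟩
    rw [← cochainMap_cechD, hbc, H.cochainMap_smul_eq_zero]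
  -- Subtracting the cocycle u from b leaves d b unchanged and makes b divisible by x; then x
  -- cancels.
  obtain ⟨u, hu, hu0, hbu⟩ : ∃ u ∈ cochainPiece f ℳ p (n + 1), cechD f M p u = 0 ∧
      cochainMap f φ (b - u) = 0 := by
    have := h hcyc
    cases p with
    | zero =>
      exact ⟨0, zero_mem _, map_zero _, by rw [sub_zero]; exact this⟩
    | succ p =>
      obtain ⟨e, he, he'⟩ := mem_coboundaryPiece_succ.mp this
      obtain ⟨e, hep, rfl⟩ := H.exists_cochainMap_eq he
      refine ⟨cechD f M p e, cechD_mem_cochainPiece H.gen_smul_mem hep, cechD_cechD e, ?_⟩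
      rw [cochainMap_sub, cochainMap_cechD, he', sub_self]
  obtain ⟨g, hg, hg'⟩ := H.exists_smul_eq_of_cochainMap_eq_zero (sub_mem hb hu) hbu
  rw [add_sub_cancel_right] at hg
  refine mem_coboundaryPiece_succ.mpr ⟨g, hg, ?_⟩
  rw [← sub_eq_zero]
  refine H.cochain_eq_zero_of_smul_eq_zero
    (sub_mem (cechD_mem_cochainPiece H.gen_smul_mem hg) hc) ?_
  rw [smul_sub, ← map_smul, hg', map_sub, hu0, sub_zero, hbc, sub_self]

/-- Vanishing of cohomology lifts from a hyperplane section by a form that acts torsionally. -/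
theorem vanishes_of_section (H : IsLinearSection f x ℳ φ 𝒩) {R : ℤ}
    (hinj : ∀ d : ℕ, R < d → ∀ m ∈ ℳ d, x • m = 0 → m = 0)
    (htor : ∀ (p : ℕ) (n : ℤ), ∀ c ∈ cocyclePiece f ℳ p n,
      ∃ a : ℕ, x ^ a • c ∈ coboundaryPiece f ℳ p (n + a))
    (h : ∀ (p : ℕ) (n : ℤ), R < n + p → Vanishes f 𝒩 p n) (p : ℕ) (n : ℤ) (hn : R < n + p) :
    Vanishes f ℳ p n := by
  intro c hc
  obtain ⟨a, ha⟩ := htor p n c hc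
  replace hc := hc.1
  -- The power of x is removed one factor at a time. Raising n keeps n + p > R, so the induction
  -- applies to x • c.
  induction a generalizing n c with
  | zero => simpa using ha
  | succ a ih =>
    have h1 : x • c ∈ coboundaryPiece f ℳ p (n + 1) := by
      refine ih (n + 1) (by linarith) ?_ (H.smul_mem_cochainPiece hc)
      rw [← mul_smul, ← pow_succ, show n + 1 + (a : ℤ) = n + ((a + 1 : ℕ) : ℤ) by push_cast; ring]
      exact ha
    -- For p = 0 coboundaries vanish and 0-cochains are elements of M, so injectivity in degrees > R
    -- suffices; for p > 0 the vanishing for the section cancels x.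
    cases p with
    | zero =>
      change x • c = 0 at h1
      change c = 0
      funext s
      have hs := mem_cochainPiece.mp hc s
      have h1 := congrFun h1 s
      change x • c s = 0 at h1
      obtain h0 | ⟨k, d, m, hm, hd, h0⟩ := eq_zero_or_eq_frac_of_mem_locPiece H.gen_smul_mem hs
      · exact h0
      · have hp : prodOn f s.1 = 1 := by rw [prodOn, Finset.card_eq_zero.mp s.2]; simp
        rw [h0, smul_frac, frac_eq_zero_iff] at h1
        obtain ⟨b, hb⟩ := h1
        rw [hp, one_pow, one_smul] at hb
        rw [s.2] at hd
        rw [h0, hinj d (by push_cast at hn hd; linarith) m hm hb, frac_zero]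
        rfl
    | succ p =>
      exact H.mem_coboundaryPiece_of_smul_mem (h p (n + 1) (by push_cast at hn; linarith)) hc h1

end IsLinearSection

/-- A torsion module has no higher cohomology. -/
theorem vanishes_of_torsion (hf : ∀ i d, ∀ m ∈ ℳ d, f i • m ∈ ℳ (d + 1))
    (htor : ∀ m : M, ∀ j, ∃ a : ℕ, f j ^ a • m = 0) {R : ℤ}
    (hzero : ∀ d : ℕ, R < d → ∀ m ∈ ℳ d, m = 0) (p : ℕ) (n : ℤ) (hn : R < n + p) :
    Vanishes f ℳ p n := by
  rintro c ⟨hc, -⟩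
  have : c = 0 := by
    funext s
    obtain h0 | ⟨k, d, m, hm, hd, h0⟩ :=
      eq_zero_or_eq_frac_of_mem_locPiece hf (mem_cochainPiece.mp hc s)
    · exact h0
    rw [h0]
    change _ = (0 : LocAt f M s.1)
    rw [frac_eq_zero_iff]
    cases p with
    | zero =>
      rw [s.2] at hd
      rw [hzero d (by push_cast at hn hd; linarith) m hm]
      exact ⟨0, smul_zero _⟩
    | succ p =>
      obtain ⟨j, hj⟩ := Finset.card_pos.mp (by rw [s.2]; omega : 0 < s.1.card)
      obtain ⟨a, ha⟩ := htor m j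
      refine ⟨a, ?_⟩
      rw [prodOn, ← Finset.prod_erase_mul s.1 f hj, mul_pow, mul_smul, ha, smul_zero]
  rw [this]
  exact zero_mem _

/-- Every localisation at a nonempty product is zero, so each element of M is a 0-cocycle: H⁰ is all
of M. -/
theorem eq_zero_of_vanishes_of_torsion (htor : ∀ m : M, ∀ j, ∃ a : ℕ, f j ^ a • m = 0) {n : ℕ}
    (h : Vanishes f ℳ 0 n) {m : M} (hm : m ∈ ℳ n) : m = 0 := by
  let c : CechCochain f M 0 := fun s => frac f s.1 m 0
  have hc : c ∈ cocyclePiece f ℳ 0 n := by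
    refine mem_cocyclePiece.mpr ⟨mem_cochainPiece.mpr fun s => frac_mem_locPiece hm (by simp), ?_⟩
    funext s
    obtain ⟨j, hj⟩ := Finset.card_pos.mp (by rw [s.2]; omega : 0 < s.1.card)
    obtain ⟨m', k, hk⟩ := exists_eq_frac (cechD f M 0 c s)
    rw [hk]
    change _ = (0 : LocAt f M s.1)
    rw [frac_eq_zero_iff]
    obtain ⟨a, ha⟩ := htor m' j
    refine ⟨a, ?_⟩
    rw [prodOn, ← Finset.prod_erase_mul s.1 f hj, mul_pow, mul_smul, ha, smul_zero]
  have h0 := congrFun (show c = 0 from h hc) ⟨∅, Finset.card_empty⟩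
  change frac f ∅ m 0 = 0 at h0
  rw [frac_eq_zero_iff] at h0
  obtain ⟨a, ha⟩ := h0
  simpa [prodOn] using ha

end Section

end FiberConeReg

end

noncomputable section

namespace FiberConeReg

/-! ### Regularity of a standard graded ring through linear sections -/

section Retract

variable {S : Type*} [CommRing S] {r : ℕ} {f : Fin r → S}
variable {M N : Type*} [AddCommGroup M] [Module S M] [AddCommGroup N] [Module S N]
variable {ℳ : ℕ → AddSubgroup M} {𝒩 : ℕ → AddSubgroup N}

theorem cochainMap_mem_cochainPiece (hf : ∀ i d, ∀ m ∈ ℳ d, f i • m ∈ ℳ (d + 1)) {φ : M →ₗ[S] N}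
    (hφ : ∀ d, ∀ m ∈ ℳ d, φ m ∈ 𝒩 d) {p : ℕ} {n : ℤ} {c : CechCochain f M p}
    (hc : c ∈ cochainPiece f ℳ p n) : cochainMap f φ c ∈ cochainPiece f 𝒩 p n := by
  rw [mem_cochainPiece]
  intro s
  obtain h0 | ⟨k, d, m, hm, hd, h0⟩ :=
    eq_zero_or_eq_frac_of_mem_locPiece hf (mem_cochainPiece.mp hc s)
  · rw [cochainMap, h0, map_zero]
    exact zero_mem _
  · rw [cochainMap, h0, locLin_frac]
    exact frac_mem_locPiece (hφ d m hm) hd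

theorem Vanishes.of_retract (hf : ∀ i d, ∀ m ∈ ℳ d, f i • m ∈ ℳ (d + 1))
    (hf' : ∀ i d, ∀ m ∈ 𝒩 d, f i • m ∈ 𝒩 (d + 1)) (φ : M →ₗ[S] N) (ψ : N →ₗ[S] M)
    (hφ : ∀ d, ∀ m ∈ ℳ d, φ m ∈ 𝒩 d) (hψ : ∀ d, ∀ m ∈ 𝒩 d, ψ m ∈ ℳ d)
    (h : ∀ m, ψ (φ m) = m) {p : ℕ} {n : ℤ} (hv : Vanishes f 𝒩 p n) : Vanishes f ℳ p n := by
  rintro c ⟨hc, hc0⟩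
  change cechD f M p c = 0 at hc0
  have e : cochainMap f ψ (cochainMap f φ c) = c := by
    funext s
    obtain ⟨m, k, hk⟩ := exists_eq_frac (c s)
    rw [cochainMap, cochainMap, hk, locLin_frac, locLin_frac, h]
  have := hv (mem_cocyclePiece.mpr ⟨cochainMap_mem_cochainPiece hf hφ hc, by
    rw [← cochainMap_cechD, hc0, cochainMap_zero]⟩)
  rw [← e]
  cases p with
  | zero =>
    rw [show cochainMap f φ c = 0 from this, cochainMap_zero]
    exact zero_mem _
  | succ p =>
    obtain ⟨b, hb, hb'⟩ := mem_coboundaryPiece_succ.mp this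
    exact mem_coboundaryPiece_succ.mpr ⟨cochainMap f ψ b, cochainMap_mem_cochainPiece hf' hψ hb,
      by rw [← cochainMap_cechD, hb']⟩

end Retract

/-- `Chain P n Q`: the ideal `Q` is obtained from `0` by successively adding `n` elements, each
of them related by `P` to the ideal constructed before it. -/
inductive Chain {B : Type*} [CommRing B] (P : Ideal B → B → Prop) : ℕ → Ideal B → Prop
  | nil : Chain P 0 ⊥
  | snoc {n : ℕ} {Q : Ideal B} {x : B} :
      Chain P n Q → P Q x → Chain P (n + 1) (Q ⊔ Ideal.span {x})

theorem Chain.mono {B : Type*} [CommRing B] {P P' : Ideal B → B → Prop}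
    (h : ∀ Q x, P Q x → P' Q x) {n : ℕ} {Q : Ideal B} (hQ : Chain P n Q) : Chain P' n Q := by
  induction hQ with
  | nil => exact .nil
  | snoc _ hx ih => exact .snoc ih (h _ _ hx)

/-! ### Chains of linear forms and bounds on the regularity -/

section Graded

variable {S : Type*} [CommRing S] (𝒜 : ℕ → AddSubgroup S)

/-- The degree `n` part of `S / Q`. -/
def quotPiece (Q : Ideal S) (n : ℕ) : AddSubgroup (S ⧸ Q) :=
  (𝒜 n).map (Ideal.Quotient.mk Q).toAddMonoidHom

/-- `x` is a linear form acting on `S / Q` with kernel torsion with respect to `S₊`. -/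
def IsTorsionForm (Q : Ideal S) (x : S) : Prop :=
  x ∈ 𝒜 1 ∧ ∀ d, ∀ z ∈ 𝒜 d, x * z ∈ Q → ∀ y ∈ 𝒜 1, ∃ a : ℕ, y ^ a * z ∈ Q

/-- `x` is a linear form acting injectively on `S / Q` in degrees greater than `R`. -/
def IsInjectiveForm (R : ℕ) (Q : Ideal S) (x : S) : Prop :=
  x ∈ 𝒜 1 ∧ ∀ d, R < d → ∀ z ∈ 𝒜 d, x * z ∈ Q → z ∈ Q

variable {𝒜}

theorem mk_mem_quotPiece {Q : Ideal S} {n : ℕ} {z : S} (hz : z ∈ 𝒜 n) :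
    (Submodule.Quotient.mk z : S ⧸ Q) ∈ quotPiece 𝒜 Q n := ⟨z, hz, rfl⟩

theorem exists_pow_smul_quotient_eq_zero {Q : Ideal S} (hQ : ∀ y ∈ 𝒜 1, ∃ a : ℕ, y ^ a ∈ Q)
    {r : ℕ} {f : Fin r → S}
    (hf : ∀ i, f i ∈ 𝒜 1) (m : S ⧸ Q) (j : Fin r) : ∃ a : ℕ, f j ^ a • m = 0 := by
  obtain ⟨z, rfl⟩ := Submodule.Quotient.mk_surjective _ m
  obtain ⟨a, ha⟩ := hQ (f j) (hf j)
  exact ⟨a, (Submodule.Quotient.mk_eq_zero Q).mpr (Q.mul_mem_right _ ha)⟩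

variable [GradedRing 𝒜]

theorem mul_mem_piece {i j : ℕ} {y z : S} (hy : y ∈ 𝒜 i) (hz : z ∈ 𝒜 j) : y * z ∈ 𝒜 (j + i) := by
  rw [add_comm]
  exact SetLike.mul_mem_graded hy hz

theorem pow_mem_piece {y : S} (hy : y ∈ 𝒜 1) (a : ℕ) : y ^ a ∈ 𝒜 a := by
  simpa using SetLike.pow_mem_graded a hy

/-- The power y^(R+1) moves z into a degree where x acts injectively. -/
theorem IsInjectiveForm.isTorsionForm {R : ℕ} {Q : Ideal S} {x : S}
    (h : IsInjectiveForm 𝒜 R Q x) : IsTorsionForm 𝒜 Q x := by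
  refine ⟨h.1, fun d z hz hxz y hy => ⟨R + 1, ?_⟩⟩
  refine h.2 _ (by omega) _ (mul_mem_piece (pow_mem_piece hy (R + 1)) hz) ?_
  rw [mul_left_comm]
  exact Q.mul_mem_left _ hxz

theorem smul_mem_quotPiece {Q : Ideal S} {e d : ℕ} {y : S} (hy : y ∈ 𝒜 e) {m : S ⧸ Q}
    (hm : m ∈ quotPiece 𝒜 Q d) : y • m ∈ quotPiece 𝒜 Q (d + e) := by
  obtain ⟨z, hz, rfl⟩ := hm
  exact ⟨y * z, mul_mem_piece hy hz, rfl⟩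

theorem Chain.isHomogeneous {P : Ideal S → S → Prop} (hP : ∀ Q x, P Q x → x ∈ 𝒜 1) {n : ℕ}
    {Q : Ideal S} (hQ : Chain P n Q) : Q.IsHomogeneous 𝒜 := by
  induction hQ with
  | nil => exact Ideal.IsHomogeneous.bot 𝒜
  | snoc _ hx ih =>
    refine Ideal.IsHomogeneous.sup ih (Ideal.homogeneous_span _ _ ?_)
    rintro _ rfl
    exact ⟨1, hP _ _ hx⟩

/-- As Q is homogeneous, the coefficient of x may be replaced by its degree d component. -/
theorem exists_component_of_mem_sup {Q : Ideal S} (hQ : Q.IsHomogeneous 𝒜) {x : S}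
    (hx : x ∈ 𝒜 1) {d : ℕ} {z : S} (hz : z ∈ 𝒜 (d + 1)) (h : z ∈ Q ⊔ Ideal.span {x}) :
    ∃ w ∈ 𝒜 d, z - x * w ∈ Q := by
  obtain ⟨q, hq, _, ht, rfl⟩ := Submodule.mem_sup.mp h
  obtain ⟨a, rfl⟩ := Ideal.mem_span_singleton'.mp ht
  refine ⟨DirectSum.decompose 𝒜 a d, SetLike.coe_mem _, ?_⟩
  have h1 := hQ (d + 1) hq
  have h2 : ((DirectSum.decompose 𝒜 (a * x) (d + 1) : 𝒜 (d + 1)) : S) =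
      DirectSum.decompose 𝒜 a d * x :=
    DirectSum.coe_decompose_mul_add_of_right_mem 𝒜 hx
  have h3 := DirectSum.decompose_of_mem_same 𝒜 hz
  rw [DirectSum.decompose_add, DirectSum.add_apply, AddSubgroup.coe_add, h2] at h3
  rw [← h3, mul_comm x, add_sub_cancel_right]
  exact h1

theorem mem_of_mem_sup {Q : Ideal S} (hQ : Q.IsHomogeneous 𝒜) {x : S}
    (hx : x ∈ 𝒜 1) {z : S} (hz : z ∈ 𝒜 0) (h : z ∈ Q ⊔ Ideal.span {x}) : z ∈ Q := by
  obtain ⟨q, hq, _, ht, rfl⟩ := Submodule.mem_sup.mp h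
  obtain ⟨a, rfl⟩ := Ideal.mem_span_singleton'.mp ht
  have h1 := hQ 0 hq
  have h2 : ((DirectSum.decompose 𝒜 (a * x) 0 : 𝒜 0) : S) = 0 :=
    DirectSum.coe_decompose_mul_of_right_mem_of_not_le 𝒜 hx (by omega)
  have h3 := DirectSum.decompose_of_mem_same 𝒜 hz
  rw [DirectSum.decompose_add, DirectSum.add_apply, AddSubgroup.coe_add, h2, add_zero] at h3
  rw [← h3]
  exact h1

variable {r : ℕ} {f : Fin r → S}

theorem isLinearSection_quotient (hf : ∀ i, f i ∈ 𝒜 1) {Q : Ideal S} (hQ : Q.IsHomogeneous 𝒜)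
    {x : S} (hx : IsTorsionForm 𝒜 Q x) :
    IsLinearSection f x (quotPiece 𝒜 Q)
      (Submodule.factor (le_sup_left : Q ≤ Q ⊔ Ideal.span {x}))
      (quotPiece 𝒜 (Q ⊔ Ideal.span {x})) where
  gen_smul_mem i d m hm := smul_mem_quotPiece (hf i) hm
  smul_mem d m hm := smul_mem_quotPiece hx.1 hm
  map_eq d := by
    rw [quotPiece, quotPiece, AddSubgroup.map_map]
    rfl
  map_smul_eq_zero m := by
    obtain ⟨z, rfl⟩ := Submodule.Quotient.mk_surjective _ m
    refine (Submodule.Quotient.mk_eq_zero (Q ⊔ Ideal.span {x})).mpr ?_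
    exact Ideal.mul_mem_right _ _ (Ideal.mem_sup_right (Ideal.mem_span_singleton_self x))
  eq_zero_of_map_eq_zero m hm h := by
    obtain ⟨z, hz, rfl⟩ := hm
    exact (Submodule.Quotient.mk_eq_zero Q).mpr
      (mem_of_mem_sup hQ hx.1 hz ((Submodule.Quotient.mk_eq_zero _).mp h))
  exists_of_map_eq_zero d m hm h := by
    obtain ⟨z, hz, rfl⟩ := hm
    obtain ⟨w, hw, hzw⟩ := exists_component_of_mem_sup hQ hx.1 hz
      ((Submodule.Quotient.mk_eq_zero _).mp h)
    exact ⟨_, mk_mem_quotPiece hw, ((Submodule.Quotient.eq Q).mpr hzw).symm⟩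
  torsion d m hm h j := by
    obtain ⟨z, hz, rfl⟩ := hm
    obtain ⟨a, ha⟩ := hx.2 d z hz ((Submodule.Quotient.mk_eq_zero Q).mp h) (f j) (hf j)
    exact ⟨a, (Submodule.Quotient.mk_eq_zero Q).mpr ha⟩

/-- A power of a linear form is a combination of powers of linear generators of `S₊`, with
homogeneous coefficients. -/
theorem exists_pow_eq_sum_mul_pow (hf : IsStandardGenerators 𝒜 f) {x : S} (hx : x ∈ 𝒜 1)
    (a : Fin r → ℕ) : ∃ (k : ℕ) (y : Fin r → S),
      (∀ j, a j ≤ k) ∧ (∀ j, y j ∈ 𝒜 (k - a j)) ∧ x ^ k = ∑ j, y j * f j ^ a j := by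
  have h1 : x ∈ (Ideal.span (Set.range fun j => f j ^ a j)).radical := by
    have h2 : Ideal.span (Set.range f) ≤ (Ideal.span (Set.range fun j => f j ^ a j)).radical := by
      rw [Ideal.span_le]
      rintro _ ⟨j, rfl⟩
      exact ⟨a j, Ideal.subset_span ⟨j, rfl⟩⟩
    refine h2 ?_
    rw [hf.2]
    exact Ideal.subset_span ⟨1, one_pos, hx⟩
  obtain ⟨k₀, hk₀⟩ := h1
  -- Adding ∑ a j to the exponent ensures that no degree k - a j is truncated in ℕ.
  have hk : x ^ (k₀ + ∑ j, a j) ∈ Ideal.span (Set.range fun j => f j ^ a j) := by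
    rw [pow_add]
    exact Ideal.mul_mem_right _ _ hk₀
  obtain ⟨y, hy⟩ := (Ideal.mem_span_range_iff_exists_fun).mp hk
  have hle : ∀ j, a j ≤ k₀ + ∑ j, a j := fun j =>
    (Finset.single_le_sum (f := a) (fun _ _ => Nat.zero_le _) (Finset.mem_univ j)).trans
      (Nat.le_add_left _ _)
  refine ⟨k₀ + ∑ j, a j, fun j => DirectSum.decompose 𝒜 (y j) (k₀ + ∑ j, a j - a j), hle,
    fun j => SetLike.coe_mem _, ?_⟩
  have h3 := DirectSum.decompose_of_mem_same 𝒜 (pow_mem_piece hx (k₀ + ∑ j, a j))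
  rw [← h3, ← hy, DirectSum.decompose_sum, DFinsupp.finsetSum_apply,
    AddSubmonoidClass.coe_finsetSum]
  refine Finset.sum_congr rfl fun j _ => ?_
  exact DirectSum.coe_decompose_mul_of_right_mem_of_le 𝒜 (pow_mem_piece (hf.1 j) (a j)) (hle j)

/-- Each generator kills the class after some power, and a high power of x is a homogeneous
combination of those powers. -/
theorem exists_form_pow_smul_mem_coboundaryPiece (hf : IsStandardGenerators 𝒜 f) {Q : Ideal S}
    {x : S} (hx : x ∈ 𝒜 1) {p : ℕ} {n : ℤ} {c : CechCochain f (S ⧸ Q) p}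
    (hc : c ∈ cocyclePiece f (quotPiece 𝒜 Q) p n) :
    ∃ a : ℕ, x ^ a • c ∈ coboundaryPiece f (quotPiece 𝒜 Q) p (n + a) := by
  have hf' : ∀ i d, ∀ m ∈ quotPiece 𝒜 Q d, f i • m ∈ quotPiece 𝒜 Q (d + 1) :=
    fun i d m hm => smul_mem_quotPiece (hf.1 i) hm
  choose a ha using fun j => exists_pow_smul_mem_coboundaryPiece hf' hc j
  obtain ⟨k, y, hk, hy, h⟩ := exists_pow_eq_sum_mul_pow hf hx a
  refine ⟨k, ?_⟩
  rw [h, Finset.sum_smul]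
  refine sum_mem fun j _ => ?_
  rw [mul_smul]
  have := smul_mem_coboundaryPiece hf' (fun d m hm => smul_mem_quotPiece (hy j) hm) (ha j)
  rwa [Nat.cast_sub (hk j), add_assoc, add_sub_cancel] at this

theorem vanishes_quotPiece_bot_iff (hf : ∀ i, f i ∈ 𝒜 1) {p : ℕ} {n : ℤ} :
    Vanishes f (quotPiece 𝒜 (⊥ : Ideal S)) p n ↔ Vanishes f 𝒜 p n := by
  have h1 : ∀ i d, ∀ m ∈ 𝒜 d, f i • m ∈ 𝒜 (d + 1) := fun i d m hm => mul_mem_piece (hf i) hm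
  have h2 : ∀ i d, ∀ m ∈ quotPiece 𝒜 (⊥ : Ideal S) d, f i • m ∈ quotPiece 𝒜 ⊥ (d + 1) :=
    fun i d m hm => smul_mem_quotPiece (hf i) hm
  let φ : S →ₗ[S] S ⧸ (⊥ : Ideal S) := Submodule.mkQ ⊥
  let ψ : (S ⧸ (⊥ : Ideal S)) →ₗ[S] S := Submodule.liftQ ⊥ LinearMap.id bot_le
  have hφ : ∀ d, ∀ m ∈ 𝒜 d, φ m ∈ quotPiece 𝒜 (⊥ : Ideal S) d := fun d m hm => ⟨m, hm, rfl⟩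
  have hψ : ∀ d, ∀ m ∈ quotPiece 𝒜 (⊥ : Ideal S) d, ψ m ∈ 𝒜 d := by
    rintro d _ ⟨m, hm, rfl⟩
    exact hm
  have hψφ : ∀ m, φ (ψ m) = m := fun m => by
    obtain ⟨z, rfl⟩ := Submodule.Quotient.mk_surjective _ m
    rfl
  exact ⟨Vanishes.of_retract h1 h2 φ ψ hφ hψ fun _ => rfl,
    Vanishes.of_retract h2 h1 ψ φ hψ hφ hψφ⟩

theorem vanishes_of_chain (hf : IsStandardGenerators 𝒜 f) {R n : ℕ} {Q : Ideal S}
    (hQ : Chain (IsInjectiveForm 𝒜 R) n Q)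
    (h : ∀ (p : ℕ) (m : ℤ), (R : ℤ) < m + p → Vanishes f (quotPiece 𝒜 Q) p m)
    (p : ℕ) (m : ℤ) (hm : (R : ℤ) < m + p) : Vanishes f 𝒜 p m := by
  induction hQ generalizing p m with
  | nil => exact (vanishes_quotPiece_bot_iff hf.1).mp (h p m hm)
  | @snoc n Q x hQ hx ih =>
    refine ih (fun p m hm => ?_) p m hm
    refine (isLinearSection_quotient hf.1 (hQ.isHomogeneous fun _ _ h => h.1)
      hx.isTorsionForm).vanishes_of_section (R := R) ?_ ?_ h p m hm
    · rintro d hd _ ⟨z, hz, rfl⟩ h0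
      exact (Submodule.Quotient.mk_eq_zero Q).mpr
        (hx.2 d (by exact_mod_cast hd) z hz ((Submodule.Quotient.mk_eq_zero Q).mp h0))
    · exact fun p n c hc => exists_form_pow_smul_mem_coboundaryPiece hf hx.1 hc

/-- The connecting map raises p and lowers m by one, so the region R < m + p is stable under passing
to each section. -/
theorem vanishes_quotient_of_chain (hf : IsStandardGenerators 𝒜 f) {R : ℤ} {n : ℕ} {Q : Ideal S}
    (hQ : Chain (IsTorsionForm 𝒜) n Q)
    (h : ∀ (p : ℕ) (m : ℤ), R < m + p → Vanishes f 𝒜 p m)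
    (p : ℕ) (m : ℤ) (hm : R < m + p) : Vanishes f (quotPiece 𝒜 Q) p m := by
  induction hQ generalizing p m with
  | nil => exact (vanishes_quotPiece_bot_iff hf.1).mpr (h p m hm)
  | @snoc n Q x hQ hx ih =>
    refine (isLinearSection_quotient hf.1 (hQ.isHomogeneous fun _ _ h => h.1)
      hx).vanishes_section (ih p m hm) (ih _ _ ?_)
    push_cast
    linarith

/-- A chain of linear forms acting injectively in degrees greater than `R`, with quotient living
in degrees at most `R`, bounds the regularity by `R`. -/
theorem reg_le_of_chain {R n : ℕ} {Q : Ideal S} (hQ : Chain (IsInjectiveForm 𝒜 R) n Q)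
    (h : ∀ d, R < d → ∀ z ∈ 𝒜 d, z ∈ Q) :
    reg 𝒜 𝒜 ≤ (((R : ℤ) : WithTop ℤ) : WithBot (WithTop ℤ)) := by
  refine iSup_le fun p => ?_
  have key : aInvariant 𝒜 𝒜 p ≤ ((((R : ℤ) - p : ℤ) : WithTop ℤ) : WithBot (WithTop ℤ)) := by
    refine sSup_le ?_
    rintro _ ⟨m, ⟨r, f, hf, hne⟩, rfl⟩
    rw [nontrivial_cechCohomology_iff] at hne
    rw [WithBot.coe_le_coe, WithTop.coe_le_coe]
    by_contra hlt
    refine hne (vanishes_of_chain hf hQ ?_ p m (by linarith))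
    refine vanishes_of_torsion (fun i d m hm => smul_mem_quotPiece (hf.1 i) hm)
      (exists_pow_smul_quotient_eq_zero (fun y hy => ⟨R + 1, ?_⟩) hf.1) ?_
    · exact h _ (Nat.lt_succ_self R) _ (pow_mem_piece hy _)
    · rintro d hd _ ⟨z, hz, rfl⟩
      exact (Submodule.Quotient.mk_eq_zero Q).mpr (h d (by exact_mod_cast hd) z hz)
  calc aInvariant 𝒜 𝒜 p + (((p : ℤ) : WithTop ℤ) : WithBot (WithTop ℤ))
      ≤ ((((R : ℤ) - p : ℤ) : WithTop ℤ) : WithBot (WithTop ℤ)) + _ := by gcongr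
    _ = _ := by
      rw [← WithBot.coe_add, ← WithTop.coe_add, sub_add_cancel]

/-- The regularity is at least the top degree of the quotient by a chain of linear forms with
torsion kernels whose quotient is torsion. -/
theorem le_reg_of_chain (hgen : ∃ (r : ℕ) (f : Fin r → S), IsStandardGenerators 𝒜 f)
    {R n : ℕ} {Q : Ideal S} (hQ : Chain (IsTorsionForm 𝒜) n Q)
    (hQ' : ∀ y ∈ 𝒜 1, ∃ a : ℕ, y ^ a ∈ Q) {z : S} (hz : z ∈ 𝒜 R) (hzQ : z ∉ Q) :
    (((R : ℤ) : WithTop ℤ) : WithBot (WithTop ℤ)) ≤ reg 𝒜 𝒜 := by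
  obtain ⟨r, f, hf⟩ := hgen
  -- Otherwise vanishing above R - 1 would descend to S / Q, whose H⁰ in degree R contains the
  -- nonzero class of z.
  obtain ⟨p, m, hm, hv⟩ : ∃ (p : ℕ) (m : ℤ), (R : ℤ) - 1 < m + p ∧ ¬ Vanishes f 𝒜 p m := by
    by_contra! hcon
    refine hzQ ((Submodule.Quotient.mk_eq_zero Q).mp ?_)
    exact eq_zero_of_vanishes_of_torsion (exists_pow_smul_quotient_eq_zero hQ' hf.1)
      (vanishes_quotient_of_chain hf hQ hcon 0 R (by simp)) (mk_mem_quotPiece hz)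
  calc (((R : ℤ) : WithTop ℤ) : WithBot (WithTop ℤ))
      ≤ (((m + p : ℤ) : WithTop ℤ) : WithBot (WithTop ℤ)) := by
        rw [WithBot.coe_le_coe, WithTop.coe_le_coe]
        linarith
    _ = ((m : WithTop ℤ) : WithBot (WithTop ℤ)) + (((p : ℤ) : WithTop ℤ) : WithBot (WithTop ℤ)) := by
        rw [← WithBot.coe_add, ← WithTop.coe_add]
    _ ≤ aInvariant 𝒜 𝒜 p + (((p : ℤ) : WithTop ℤ) : WithBot (WithTop ℤ)) := by
        gcongr
        exact le_sSup ⟨m, ⟨r, f, hf, nontrivial_cechCohomology_iff.mpr hv⟩, rfl⟩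
    _ ≤ reg 𝒜 𝒜 := le_iSup (fun i : ℕ => aInvariant 𝒜 𝒜 i +
        (((i : ℤ) : WithTop ℤ) : WithBot (WithTop ℤ))) p

end Graded

end FiberConeReg

end

noncomputable section

namespace FiberConeReg

/-! ### Regular sequences modulo an ideal -/

section Grade

variable {B : Type*} [CommRing B]

/-- Multiplication by `x` is injective modulo `Q`. -/
def RegularMod (Q : Ideal B) (x : B) : Prop := ∀ z, x * z ∈ Q → z ∈ Q

/-- No element outside `Q` is multiplied into `Q` by `J`. -/
def ColonEq (J Q : Ideal B) : Prop := ∀ z, (∀ y ∈ J, y * z ∈ Q) → z ∈ Q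

/-- There is a sequence of length `n` in `J` that is weakly regular modulo `Q`. -/
def HasRegSeq (J : Ideal B) : ℕ → Ideal B → Prop
  | 0, _ => True
  | n + 1, Q => ∃ a ∈ J, RegularMod Q a ∧ HasRegSeq J n (Q ⊔ Ideal.span {a})

theorem mem_sup_span_iff {Q : Ideal B} {a z : B} :
    z ∈ Q ⊔ Ideal.span {a} ↔ ∃ w, z - a * w ∈ Q := by
  constructor
  · intro h
    obtain ⟨q, hq, _, ht, rfl⟩ := Submodule.mem_sup.mp h
    obtain ⟨w, rfl⟩ := Ideal.mem_span_singleton'.mp ht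
    exact ⟨w, by rwa [mul_comm a, add_sub_cancel_right]⟩
  · rintro ⟨w, hw⟩
    rw [← sub_add_cancel z (a * w)]
    exact add_mem (Ideal.mem_sup_left hw)
      (Ideal.mem_sup_right (Ideal.mul_mem_right _ _ (Ideal.mem_span_singleton_self a)))

theorem HasRegSeq.colonEq {J Q : Ideal B} {n : ℕ} (h : HasRegSeq J (n + 1) Q) : ColonEq J Q := by
  obtain ⟨a, ha, hreg, -⟩ := h
  exact fun z hz => hreg z (hz a ha)

/-- This half of the permutability of regular sequences needs no local or graded hypothesis. -/
theorem RegularMod.swap {Q : Ideal B} {a b : B} (ha : RegularMod Q a)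
    (hb : RegularMod (Q ⊔ Ideal.span {a}) b) : RegularMod (Q ⊔ Ideal.span {b}) a := by
  intro z hz
  obtain ⟨w, hw⟩ := mem_sup_span_iff.mp hz
  have h1 : w ∈ Q ⊔ Ideal.span {a} := hb w (mem_sup_span_iff.mpr ⟨z, by
    rw [← neg_sub]
    exact neg_mem hw⟩)
  obtain ⟨v, hv⟩ := mem_sup_span_iff.mp h1
  refine mem_sup_span_iff.mpr ⟨v, ha _ ?_⟩
  rw [show a * (z - b * v) = (a * z - b * w) + b * (w - a * v) by ring]
  exact add_mem hw (Q.mul_mem_left _ hv)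

/-- The rule z ↦ w with a z ≡ b w modulo Q carries elements killed by J modulo (Q, b) to elements
killed by J modulo (Q, a). If w ∈ (Q, a), cancelling a gives z ∈ (Q, b). -/
theorem ColonEq.change {J Q : Ideal B} {a b : B} (haJ : a ∈ J) (ha : RegularMod Q a)
    (hb : RegularMod Q b) (h : ColonEq J (Q ⊔ Ideal.span {a})) :
    ColonEq J (Q ⊔ Ideal.span {b}) := by
  intro z hz
  obtain ⟨w, hw⟩ := mem_sup_span_iff.mp (hz a haJ)
  have h1 : w ∈ Q ⊔ Ideal.span {a} := by
    refine h w fun y hy => ?_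
    obtain ⟨u, hu⟩ := mem_sup_span_iff.mp (hz y hy)
    refine mem_sup_span_iff.mpr ⟨u, hb _ ?_⟩
    rw [show b * (y * w - a * u) = a * (y * z - b * u) - y * (a * z - b * w) by ring]
    exact sub_mem (Q.mul_mem_left _ hu) (Q.mul_mem_left _ hw)
  obtain ⟨v, hv⟩ := mem_sup_span_iff.mp h1
  refine mem_sup_span_iff.mpr ⟨v, ha _ ?_⟩
  rw [show a * (z - b * v) = (a * z - b * w) + b * (w - a * v) by ring]
  exact add_mem hw (Q.mul_mem_left _ hv)

/-! ### Exchange of regular elements over Noetherian rings -/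

section Noetherian

variable [IsNoetherianRing B]

theorem mem_associatedPrimes_quotient {Q P : Ideal B} (hP : P ∈ associatedPrimes B (B ⧸ Q)) :
    ∃ z ∉ Q, ∀ y, y ∈ P ↔ y * z ∈ Q := by
  obtain ⟨hp, m, hm⟩ := isAssociatedPrime_iff.mp hP
  obtain ⟨z, rfl⟩ := Submodule.Quotient.mk_surjective _ m
  have h : ∀ y, y ∈ P ↔ y * z ∈ Q := fun y => by
    rw [hm, Submodule.mem_colon_singleton, Submodule.mem_bot, ← Submodule.Quotient.mk_smul,
      Submodule.Quotient.mk_eq_zero, smul_eq_mul]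
  exact ⟨z, fun hz => hp.ne_top ((Ideal.eq_top_iff_one _).mpr ((h 1).mpr (by rwa [one_mul]))), h⟩

theorem regularMod_of_forall_notMem {Q : Ideal B} {x : B}
    (h : ∀ P ∈ associatedPrimes B (B ⧸ Q), x ∉ P) : RegularMod Q x := by
  intro z hz
  by_contra hzQ
  obtain ⟨P, hP, hle⟩ := exists_le_isAssociatedPrime_of_isNoetherianRing B
    (Submodule.Quotient.mk z : B ⧸ Q) (fun h0 => hzQ ((Submodule.Quotient.mk_eq_zero Q).mp h0))
  refine h P hP (hle ?_)
  rw [Submodule.mem_colon_singleton, Submodule.mem_bot, ← Submodule.Quotient.mk_smul,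
    Submodule.Quotient.mk_eq_zero]
  exact hz

theorem ColonEq.not_le {J Q P : Ideal B} (h : ColonEq J Q)
    (hP : P ∈ associatedPrimes B (B ⧸ Q)) : ¬ J ≤ P := by
  intro hle
  obtain ⟨z, hz, hzP⟩ := mem_associatedPrimes_quotient hP
  exact hz (h z fun y hy => (hzP y).mp (hle hy))

/-- Prime avoidance for the finitely many associated primes of all the quotients together; none of
them contains J. -/
theorem exists_regularMod {J : Ideal B} {T : Set (Ideal B)} (hT : T.Finite)
    (h : ∀ Q ∈ T, ColonEq J Q) : ∃ b ∈ J, ∀ Q ∈ T, RegularMod Q b := by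
  have hfin : (⋃ Q ∈ T, associatedPrimes B (B ⧸ Q)).Finite :=
    hT.biUnion fun Q _ => associatedPrimes.finite B (B ⧸ Q)
  have hnot : ¬ ((J : Set B) ⊆ ⋃ P ∈ ⋃ Q ∈ T, associatedPrimes B (B ⧸ Q), (P : Set B)) := by
    rw [Ideal.subset_union_prime_finite hfin ⊥ ⊥]
    · rintro ⟨P, hP, hle⟩
      obtain ⟨Q, hQ, hP⟩ := Set.mem_iUnion₂.mp hP
      exact (h Q hQ).not_le hP hle
    · intro P hP _ _
      obtain ⟨Q, hQ, hP⟩ := Set.mem_iUnion₂.mp hP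
      exact hP.isPrime
  obtain ⟨b, hb, hb'⟩ := Set.not_subset.mp hnot
  refine ⟨b, hb, fun Q hQ => regularMod_of_forall_notMem fun P hP hbP => hb' ?_⟩
  exact Set.mem_iUnion₂.mpr ⟨P, Set.mem_iUnion₂.mpr ⟨Q, hQ, hP⟩, hbP⟩

/-- The length of regular sequences in `J` drops by at most one modulo any regular element. -/
theorem HasRegSeq.quotient {J : Ideal B} {n : ℕ} {Q : Ideal B} (h : HasRegSeq J (n + 1) Q)
    {y : B} (hy : y ∈ J) (hreg : RegularMod Q y) : HasRegSeq J n (Q ⊔ Ideal.span {y}) := by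
  induction n generalizing Q y with
  | zero => trivial
  | succ n ih =>
    obtain ⟨a, haJ, ha, hs⟩ := h
    -- The element b mediates the exchange: a is traded for b, then b for y, each time using the
    -- induction hypothesis for a shorter sequence.
    obtain ⟨b, hbJ, hb⟩ := exists_regularMod (J := J)
      (T := {Q, Q ⊔ Ideal.span {a}, Q ⊔ Ideal.span {y}}) (by simp) (by
        rintro _ (rfl | rfl | rfl)
        · exact fun z hz => ha z (hz a haJ)
        · exact hs.colonEq
        · exact hs.colonEq.change haJ ha hreg)
    have hbQ := hb Q (by simp)
    have hba := hb (Q ⊔ Ideal.span {a}) (by simp)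
    have hby := hb (Q ⊔ Ideal.span {y}) (by simp)
    have h1 : HasRegSeq J (n + 1) (Q ⊔ Ideal.span {b}) := by
      refine ⟨a, haJ, ha.swap hba, ?_⟩
      rw [sup_right_comm]
      exact ih hs hbJ hba
    refine ⟨b, hbJ, hby, ?_⟩
    rw [sup_right_comm]
    exact ih h1 hy (hreg.swap hby)

theorem HasRegSeq.of_chain {J : Ideal B} {P : Ideal B → B → Prop}
    (hP : ∀ Q x, P Q x → x ∈ J ∧ RegularMod Q x) {g n : ℕ} (h : HasRegSeq J g ⊥) {Q : Ideal B}
    (hQ : Chain P n Q) (hn : n ≤ g) : HasRegSeq J (g - n) Q := by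
  induction hQ with
  | nil => exact h
  | @snoc n Q x _ hx ih =>
    have h1 := ih (by omega)
    rw [show g - n = g - (n + 1) + 1 by omega] at h1
    exact h1.quotient (hP _ _ hx).1 (hP _ _ hx).2

end Noetherian

theorem hasRegSeq_of_le_grade {J : Ideal B} {n : ℕ} (h : (n : ℕ∞) ≤ grade J) :
    HasRegSeq J n ⊥ := by
  obtain ⟨rs, hrs, hreg, hn⟩ : ∃ rs : List B, (∀ x ∈ rs, x ∈ J) ∧
      RingTheory.Sequence.IsWeaklyRegular B rs ∧ n ≤ rs.length := by
    -- Only weak regularity is needed, so the empty sequence serves for n = 0 even over the zero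
    -- ring.
    rcases n with _ | n
    · exact ⟨[], by simp, by simp, by simp⟩
    by_contra! hcon
    refine absurd (h.trans (sSup_le (a := (n : ℕ∞)) ?_)) ?_
    · rintro _ ⟨rs, hrs, hreg, rfl⟩
      exact_mod_cast Nat.lt_succ_iff.mp (hcon rs hrs hreg.toIsWeaklyRegular)
    · rw [not_le]
      exact_mod_cast Nat.lt_succ_self n
  -- The sequence is built from its end: k elements remain modulo the first n - k.
  have key : ∀ k ≤ n, HasRegSeq J k (Ideal.ofList (rs.take (n - k))) := by
    intro k
    induction k with
    | zero => exact fun _ => trivial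
    | succ k ih =>
      intro hk
      have hlt : n - (k + 1) < rs.length := by omega
      refine ⟨rs[n - (k + 1)], hrs _ (List.getElem_mem hlt), ?_, ?_⟩
      · intro z hz
        have := hreg.regular_mod_prev _ hlt
        rw [smul_eq_mul, Ideal.mul_top] at this
        rw [← Submodule.Quotient.mk_eq_zero (Ideal.ofList (rs.take (n - (k + 1))))] at hz ⊢
        exact this.right_eq_zero_of_smul hz
      · have := ih (by omega)
        rw [show n - k = n - (k + 1) + 1 by omega, List.take_succ_eq_append_getElem hlt,
          Ideal.ofList_append, Ideal.ofList_singleton] at this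
        exact this
  simpa using key n le_rfl

end Grade

/-- Over a local ring with infinite residue field, an ideal is not covered by finitely many ideals
that do not contain it. -/
theorem exists_mem_forall_notMem {A : Type*} [CommRing A] [IsLocalRing A]
    [Infinite (IsLocalRing.ResidueField A)] (I : Ideal A) {T : Set (Ideal A)} (hT : T.Finite)
    (h : ∀ N ∈ T, ¬ I ≤ N) : ∃ x ∈ I, ∀ N ∈ T, x ∉ N := by
  by_contra! hcon
  have hcov : ⋃ N ∈ hT.toFinset, ((Submodule.comap I.subtype N : Submodule A I) : Set I) =
      Set.univ := by
    rw [Set.eq_univ_iff_forall]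
    rintro ⟨x, hx⟩
    obtain ⟨N, hN, hxN⟩ := hcon x hx
    exact Set.mem_iUnion₂.mpr ⟨N, hT.mem_toFinset.mpr hN, hxN⟩
  -- In a finite cover by subgroups one has finite index. The cyclic submodule generated by some z ∈
  -- I outside N is then finite modulo N and nonzero, and surjects onto the residue field.
  obtain ⟨N, hN, hfi⟩ := Submodule.exists_finiteIndex_of_cover hcov
  have : Finite (I ⧸ (Submodule.comap I.subtype N : Submodule A I)) :=
    AddSubgroup.finite_quotient_of_finiteIndex
  obtain ⟨z, hz, hzN⟩ := SetLike.not_le_iff_exists.mp (h N (hT.mem_toFinset.mp hN))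
  let φ : A →ₗ[A] I ⧸ (Submodule.comap I.subtype N : Submodule A I) :=
    LinearMap.toSpanSingleton A _ (Submodule.Quotient.mk ⟨z, hz⟩)
  have hker : LinearMap.ker φ ≤ IsLocalRing.maximalIdeal A := by
    refine IsLocalRing.le_maximalIdeal fun htop => hzN ?_
    have h1 : φ 1 = 0 := by
      rw [← LinearMap.mem_ker, htop]
      trivial
    rw [LinearMap.toSpanSingleton_apply, one_smul, Submodule.Quotient.mk_eq_zero] at h1
    exact h1
  have : Finite (A ⧸ LinearMap.ker φ) :=
    Finite.of_injective _ (LinearMap.ker_eq_bot.mp (Submodule.ker_liftQ_eq_bot _ φ le_rfl le_rfl))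
  have : Finite (IsLocalRing.ResidueField A) :=
    Finite.of_surjective (Ideal.Quotient.factor hker) (Ideal.Quotient.factor_surjective hker)
  exact not_finite (IsLocalRing.ResidueField A)

end FiberConeReg

end

noncomputable section

namespace FiberConeReg

/-! ### Filter-regular sequences -/

section FilterRegular

variable {B : Type*} [CommRing B]

/-- `x` is regular modulo a sufficiently large colon ideal `Q : J ^ N`. -/
def FilterRegularMod (J Q : Ideal B) (x : B) : Prop :=
  ∃ N : ℕ, RegularMod (Submodule.colon Q ((J ^ N : Ideal B) : Set B)) x

theorem mem_colon_pow {J Q : Ideal B} {N : ℕ} {z : B} :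
    z ∈ Submodule.colon Q ((J ^ N : Ideal B) : Set B) ↔ ∀ y ∈ J ^ N, y * z ∈ Q := by
  rw [Submodule.mem_colon]
  simp only [smul_eq_mul, mul_comm z, SetLike.mem_coe]

theorem FilterRegularMod.exists_pow_mul_mem {J Q : Ideal B} {x : B} (h : FilterRegularMod J Q x) :
    ∃ N : ℕ, ∀ z, x * z ∈ Q → ∀ y ∈ J ^ N, y * z ∈ Q := by
  obtain ⟨N, hN⟩ := h
  refine ⟨N, fun z hz => mem_colon_pow.mp (hN z (mem_colon_pow.mpr fun y _ => ?_))⟩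
  exact Q.mul_mem_left _ hz

theorem ColonEq.colon_pow_eq {J Q : Ideal B} (h : ColonEq J Q) (N : ℕ) :
    Submodule.colon Q ((J ^ N : Ideal B) : Set B) = Q := by
  refine le_antisymm (fun z hz => ?_)
    (fun z hz => mem_colon_pow.mpr fun y _ => Q.mul_mem_left _ hz)
  rw [mem_colon_pow] at hz
  induction N generalizing z with
  | zero => simpa using hz 1 (by simp)
  | succ N ih =>
    refine h z fun y hy => ih _ fun w hw => ?_
    rw [← mul_assoc]
    exact hz _ (by rw [pow_succ]; exact Ideal.mul_mem_mul hw hy)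

theorem FilterRegularMod.regularMod {J Q : Ideal B} {x : B} (h : FilterRegularMod J Q x)
    (hQ : ColonEq J Q) : RegularMod Q x := by
  obtain ⟨N, hN⟩ := h
  rwa [hQ.colon_pow_eq] at hN

variable [IsNoetherianRing B]

/-- The ascending colon ideals stabilise at the saturation of Q with respect to J. -/
theorem exists_colonEq_colon_pow (J Q : Ideal B) :
    ∃ N : ℕ, ColonEq J (Submodule.colon Q ((J ^ N : Ideal B) : Set B)) := by
  have hmono : Monotone fun N : ℕ => (Submodule.colon Q ((J ^ N : Ideal B) : Set B) : Ideal B) := by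
    intro m n hmn z hz
    rw [mem_colon_pow] at hz ⊢
    exact fun y hy => hz y (Ideal.pow_le_pow_right hmn hy)
  obtain ⟨N, hN⟩ := monotone_stabilizes_iff_noetherian.mpr ‹_› ⟨_, hmono⟩
  refine ⟨N, fun z hz => ?_⟩
  have hN' := hN (N + 1) (Nat.le_succ N)
  change (Submodule.colon Q ((J ^ N : Ideal B) : Set B) : Ideal B) =
    Submodule.colon Q ((J ^ (N + 1) : Ideal B) : Set B) at hN'
  rw [hN', mem_colon_pow]
  intro y hy
  rw [pow_succ] at hy
  refine Submodule.mul_induction_on hy (fun w hw u hu => ?_) (fun u v hu hv => ?_)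
  · rw [mul_assoc]
    exact mem_colon_pow.mp (hz u hu) w hw
  · rw [add_mul]
    exact add_mem hu hv

/-- A filter-regular x avoids every associated prime of B / Q not containing J. A minimal prime of Q
below P therefore lies strictly below P, and each step of the chain raises the height. -/
theorem height_le_of_chain {J : Ideal B} {n : ℕ} {Q : Ideal B}
    (hQ : Chain (FilterRegularMod J) n Q) (P : Ideal B) [hP : P.IsPrime] (hle : Q ≤ P)
    (hJ : ¬ J ≤ P) : (n : ℕ∞) ≤ P.height := by
  induction hQ generalizing P with
  | nil => simp
  | @snoc n Q x _ hx ih =>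
    obtain ⟨P', hP', hP'le⟩ := Ideal.exists_minimalPrimes_le (le_sup_left.trans hle)
    have : P'.IsPrime := hP'.isPrime
    have hJ' : ¬ J ≤ P' := fun h => hJ (h.trans hP'le)
    have hass : P' ∈ associatedPrimes B (B ⧸ Q) := by
      apply Module.associatedPrimes.minimalPrimes_annihilator_subset_associatedPrimes B (B ⧸ Q)
      rwa [Ideal.annihilator_quotient]
    have hxP' : x ∉ P' := by
      intro hxP
      obtain ⟨z, hz, hzP⟩ := mem_associatedPrimes_quotient hass
      obtain ⟨N, hN⟩ := hx.exists_pow_mul_mem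
      have h1 : J ^ N ≤ P' := fun y hy => (hzP y).mpr (hN z ((hzP x).mp hxP) y hy)
      exact hJ' (Ideal.IsPrime.le_of_pow_le h1)
    have hlt : P' < P := by
      refine lt_of_le_of_ne hP'le ?_
      rintro rfl
      exact hxP' (hle (Ideal.mem_sup_right (Ideal.mem_span_singleton_self x)))
    calc ((n + 1 : ℕ) : ℕ∞) = n + 1 := by push_cast; rfl
      _ ≤ P'.height + 1 := by gcongr; exact ih P' hP'.1.2 hJ'
      _ ≤ P.height := Ideal.height_add_one_le_of_lt_of_isPrime hlt

/-- A filter-regular sequence of linear forms of length `dim S` generates an ideal containing a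
power of `S₊`. -/
theorem exists_irrelevantIdeal_pow_le (𝒜 : ℕ → AddSubgroup B) [GradedRing 𝒜] {n : ℕ}
    (hdim : ringKrullDim B = (n : WithBot ℕ∞)) {Q : Ideal B}
    (hQ : Chain (FilterRegularMod (irrelevantIdeal 𝒜)) n Q) (hhom : Q.IsHomogeneous 𝒜) :
    ∃ N : ℕ, irrelevantIdeal 𝒜 ^ N ≤ Q := by
  refine Ideal.exists_pow_le_of_le_radical_of_fg ?_ (IsNoetherian.noetherian _)
  rw [Ideal.radical_eq_sInf]
  refine le_sInf fun P ⟨hQP, hP⟩ => ?_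
  by_contra hJ
  -- The homogeneous core still contains Q and not S₊, so its height is at least n. Being
  -- homogeneous, it is proper together with S₊, hence strictly below a maximal ideal, whose height
  -- would exceed the dimension.
  have hcore : (P.homogeneousCore 𝒜).toIdeal.IsPrime := hP.homogeneousCore
  have hcoreP : (P.homogeneousCore 𝒜).toIdeal ≤ P := Ideal.toIdeal_homogeneousCore_le 𝒜 P
  have hQcore : Q ≤ (P.homogeneousCore 𝒜).toIdeal := by
    rw [← hhom.toIdeal_homogeneousCore_eq_self]
    exact Ideal.homogeneousCore_mono 𝒜 hQP
  have hJcore : ¬ irrelevantIdeal 𝒜 ≤ (P.homogeneousCore 𝒜).toIdeal := fun h => hJ (h.trans hcoreP)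
  have hheight := height_le_of_chain hQ _ hQcore hJcore
  have hirr : irrelevantIdeal 𝒜 ≤ (HomogeneousIdeal.irrelevant 𝒜).toIdeal := by
    rw [irrelevantIdeal, Ideal.span_le]
    rintro x ⟨i, hi, hx⟩
    exact HomogeneousIdeal.mem_irrelevant_of_mem 𝒜 hi hx
  have hne : (P.homogeneousCore 𝒜).toIdeal ⊔ irrelevantIdeal 𝒜 ≠ ⊤ := by
    rw [Ne, Ideal.eq_top_iff_one]
    intro h1
    obtain ⟨p, hp, j, hj, hpj⟩ := Submodule.mem_sup.mp h1
    have hj0 := (HomogeneousIdeal.mem_irrelevant_iff 𝒜 j).mp (hirr hj)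
    have h2 : GradedRing.proj 𝒜 0 p = 1 := by
      have := congrArg (GradedRing.proj 𝒜 0) hpj
      rw [map_add, hj0, add_zero] at this
      rw [this, GradedRing.proj_apply]
      exact DirectSum.decompose_of_mem_same 𝒜 SetLike.GradedOne.one_mem
    apply hcore.ne_top
    rw [Ideal.eq_top_iff_one, ← h2]
    exact (P.homogeneousCore 𝒜).isHomogeneous 0 hp
  obtain ⟨m, hm, hle⟩ := Ideal.exists_le_maximal _ hne
  have := hm.isPrime
  have hlt : (P.homogeneousCore 𝒜).toIdeal < m :=
    lt_of_le_of_ne (le_sup_left.trans hle) fun h => hJcore (h ▸ le_sup_right.trans hle)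
  have h1 := Ideal.height_add_one_le_of_lt_of_isPrime hlt
  have h2 : ((n + 1 : ℕ) : ℕ∞) ≤ m.height := by
    push_cast
    exact le_trans (by gcongr) h1
  have h3 : (((n + 1 : ℕ) : ℕ∞) : WithBot ℕ∞) ≤ ((n : ℕ∞) : WithBot ℕ∞) :=
    (WithBot.coe_le_coe.mpr h2).trans (Ideal.height_le_ringKrullDim_of_isPrime.trans_eq hdim)
  rw [WithBot.coe_le_coe, Nat.cast_le] at h3
  omega

end FilterRegular

end FiberConeReg

end

noncomputable section

namespace FiberConeReg

/-! ### The grading of `⨁ₙ Iⁿ / J Iⁿ` -/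

section Rees

universe u
variable {A : Type u} [CommRing A] {I : Ideal A}

/-- The element `a tⁿ` of the Rees algebra. -/
def reesMonomial (n : ℕ) (a : ↥(I ^ n)) : reesAlgebra I :=
  ⟨Polynomial.monomial n (a : A), reesAlgebra.monomial_mem.mpr a.2⟩

theorem coeff_reesMonomial (n m : ℕ) (a : ↥(I ^ n)) :
    (reesMonomial n a : Polynomial A).coeff m = if n = m then (a : A) else 0 :=
  Polynomial.coeff_monomial

variable {S : Type*} [CommRing S] (π : reesAlgebra I →+* S)

/-- The grading of a graded quotient of the Rees algebra. -/
def piece (n : ℕ) : AddSubgroup S := (reesPiece I n).map π.toAddMonoidHom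

/-- The class of `a tⁿ` in a quotient of the Rees algebra. -/
def cls (n : ℕ) (a : ↥(I ^ n)) : S := π (reesMonomial n a)

theorem mem_piece {n : ℕ} {z : S} : z ∈ piece π n ↔ ∃ a : ↥(I ^ n), cls π n a = z := by
  constructor
  · rintro ⟨p, ⟨a, ha⟩, rfl⟩
    change Polynomial.monomial n a = (p : Polynomial A) at ha
    have hp : Polynomial.monomial n a ∈ reesAlgebra I := ha ▸ p.2
    exact ⟨⟨a, reesAlgebra.monomial_mem.mp hp⟩, congrArg π (Subtype.ext ha)⟩
  · rintro ⟨a, rfl⟩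
    exact ⟨reesMonomial n a, ⟨(a : A), rfl⟩, rfl⟩

theorem cls_mem (n : ℕ) (a : ↥(I ^ n)) : cls π n a ∈ piece π n := (mem_piece π).mpr ⟨a, rfl⟩

theorem cls_add (n : ℕ) (a b : ↥(I ^ n)) : cls π n (a + b) = cls π n a + cls π n b := by
  rw [cls, cls, cls, ← map_add]
  exact congrArg π (Subtype.ext (map_add (Polynomial.monomial n) _ _))

theorem cls_zero (n : ℕ) : cls π n 0 = 0 := by
  rw [cls, ← map_zero π]
  exact congrArg π (Subtype.ext (map_zero (Polynomial.monomial n)))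

theorem cls_smul (n : ℕ) (c : A) (a : ↥(I ^ n)) :
    cls π n (c • a) = π (algebraMap A (reesAlgebra I) c) * cls π n a := by
  rw [cls, cls, ← map_mul]
  exact congrArg π (Subtype.ext (Polynomial.C_mul_monomial).symm)

theorem cls_mul_cls {n m : ℕ} (a : ↥(I ^ n)) (b : ↥(I ^ m)) :
    cls π n a * cls π m b =
      cls π (n + m) ⟨a * b, by rw [pow_add]; exact Ideal.mul_mem_mul a.2 b.2⟩ := by
  rw [cls, cls, cls, ← map_mul]
  exact congrArg π (Subtype.ext (Polynomial.monomial_mul_monomial _ _ _ _))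

/-- The linear form `x t` for `x ∈ I`. -/
def linForm (x : I) : S := cls π 1 ⟨x, by rw [pow_one]; exact x.2⟩

theorem linForm_mem (x : I) : linForm π x ∈ piece π 1 := cls_mem π _ _

theorem linForm_add (x y : I) : linForm π (x + y) = linForm π x + linForm π y :=
  cls_add π 1 ⟨x, by rw [pow_one]; exact x.2⟩ ⟨y, by rw [pow_one]; exact y.2⟩

theorem linForm_zero : linForm π 0 = 0 := cls_zero π 1

theorem linForm_smul (c : A) (x : I) :
    linForm π (c • x) = π (algebraMap A (reesAlgebra I) c) * linForm π x :=
  cls_smul π 1 c ⟨x, by rw [pow_one]; exact x.2⟩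

theorem linForm_mul_cls {n : ℕ} (x : I) (a : ↥(I ^ n)) :
    linForm π x * cls π n a =
      cls π (n + 1) ⟨x * a, by rw [pow_succ']; exact Ideal.mul_mem_mul x.2 a.2⟩ := by
  rw [linForm, cls, cls, cls, ← map_mul]
  refine congrArg π (Subtype.ext ?_)
  exact (Polynomial.monomial_mul_monomial _ _ _ _).trans (by rw [add_comm]; rfl)

/-- The ideal generated by the linear forms `x t` with `x ∈ Q`. -/
def formIdeal (Q : Ideal A) : Ideal S :=
  Ideal.span (linForm π '' {x : I | (x : A) ∈ Q})

variable (I) (J : Ideal A) in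
/-- The ideal of those `a ∈ Iⁿ` whose class in degree `n` lies in `formIdeal π Q`. -/
def stage (Q : Ideal A) : ℕ → Ideal A
  | 0 => J
  | n + 1 => J * I ^ (n + 1) ⊔ Q * I ^ n

theorem mul_pow_le_stage (J Q : Ideal A) (n : ℕ) : J * I ^ n ≤ stage I J Q n := by
  cases n with
  | zero => simp [stage]
  | succ n => exact le_sup_left

theorem pow_mul_mem_stage (J : Ideal A) {Q : Ideal A} {n m : ℕ} {a b : A} (ha : a ∈ I ^ m)
    (hb : b ∈ stage I J Q n) : a * b ∈ stage I J Q (m + n) := by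
  have h1 : I ^ m * stage I J Q n ≤ stage I J Q (m + n) := by
    cases n with
    | zero =>
      rw [mul_comm]
      exact mul_pow_le_stage J Q m
    | succ n =>
      change I ^ m * (J * I ^ (n + 1) ⊔ Q * I ^ n) ≤ J * I ^ (m + n + 1) ⊔ Q * I ^ (m + n)
      rw [Ideal.mul_sup]
      refine sup_le_sup (le_of_eq ?_) (le_of_eq ?_) <;> ring
  exact h1 (Ideal.mul_mem_mul ha hb)

/-- The ideal of the Rees algebra of elements all of whose coefficients lie in the stages. -/
def stageIdeal (J Q : Ideal A) : Ideal (reesAlgebra I) where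
  carrier := {p | ∀ n, (p : Polynomial A).coeff n ∈ stage I J Q n}
  add_mem' hp hq n := by
    rw [Subalgebra.coe_add, Polynomial.coeff_add]
    exact add_mem (hp n) (hq n)
  zero_mem' n := by
    rw [Subalgebra.coe_zero, Polynomial.coeff_zero]
    exact zero_mem _
  smul_mem' c p hp n := by
    rw [smul_eq_mul, Subalgebra.coe_mul, Polynomial.coeff_mul]
    refine sum_mem fun ⟨i, j⟩ hij => ?_
    rw [← Finset.HasAntidiagonal.mem_antidiagonal.mp hij]
    exact pow_mul_mem_stage J (c.2 i) (hp j)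

theorem map_le_stageIdeal (J Q : Ideal A) :
    J.map (algebraMap A (reesAlgebra I)) ≤ stageIdeal J Q := by
  rw [Ideal.map_le_iff_le_comap]
  intro c hc m
  change (Polynomial.C c).coeff m ∈ _
  rw [Polynomial.coeff_C]
  split_ifs with hm
  · subst hm
    exact hc
  · exact zero_mem _

variable {π} {J : Ideal A} (hπ : Function.Surjective π)
  (hker : RingHom.ker π = J.map (algebraMap A (reesAlgebra I)))

include hπ hker in
-- Both the kernel of π and lifts of the generating forms lie in `stageIdeal`, where membership is
-- read off coefficientwise.
theorem mem_stage_of_cls_mem {Q : Ideal A} {n : ℕ} {a : ↥(I ^ n)}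
    (h : cls π n a ∈ formIdeal π Q) : (a : A) ∈ stage I J Q n := by
  have h1 : formIdeal π Q ≤ (stageIdeal J Q).map π := by
    rw [formIdeal, Ideal.span_le]
    rintro _ ⟨x, hx, rfl⟩
    refine Ideal.mem_map_of_mem π (fun m => ?_)
    rw [coeff_reesMonomial]
    split_ifs with hm
    · subst hm
      refine Ideal.mem_sup_right ?_
      simpa using hx
    · exact zero_mem _
  obtain ⟨p, hp, hpa⟩ := (Ideal.mem_map_iff_of_surjective π hπ).mp (h1 h)
  have h2 : reesMonomial n a - p ∈ stageIdeal J Q := by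
    refine map_le_stageIdeal J Q ?_
    rw [← hker, RingHom.mem_ker, map_sub, hpa, cls, sub_self]
  have h3 : reesMonomial n a ∈ stageIdeal J Q := by
    rw [← sub_add_cancel (reesMonomial n a) p]
    exact add_mem h2 hp
  have h4 := h3 n
  rwa [coeff_reesMonomial, if_pos rfl] at h4

include hker in
theorem exists_cls_eq_zero_of_mem_mul {n : ℕ} {b : A} (hb : b ∈ J * I ^ n) :
    ∃ hb : b ∈ I ^ n, cls π n ⟨b, hb⟩ = 0 := by
  refine Submodule.mul_induction_on hb (fun c hc b hb => ?_) ?_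
  · refine ⟨Ideal.mul_mem_left _ _ hb, ?_⟩
    have h0 : π (algebraMap A (reesAlgebra I) c) = 0 := by
      rw [← RingHom.mem_ker, hker]
      exact Ideal.mem_map_of_mem _ hc
    have := cls_smul π n c ⟨b, hb⟩
    rw [h0, zero_mul] at this
    exact this
  · rintro b c ⟨hb, hb'⟩ ⟨hc, hc'⟩
    refine ⟨add_mem hb hc, ?_⟩
    have := cls_add π n ⟨b, hb⟩ ⟨c, hc⟩
    rw [hb', hc', add_zero] at this
    exact this

theorem exists_cls_mem_of_mem_mul {Q : Ideal A} (hQ : Q ≤ I) {n : ℕ} {c : A}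
    (hc : c ∈ Q * I ^ n) : ∃ hc : c ∈ I ^ (n + 1), cls π (n + 1) ⟨c, hc⟩ ∈ formIdeal π Q := by
  refine Submodule.mul_induction_on hc (fun x hx b hb => ?_) ?_
  · refine ⟨by rw [pow_succ']; exact Ideal.mul_mem_mul (hQ hx) hb, ?_⟩
    have := linForm_mul_cls π ⟨x, hQ hx⟩ ⟨b, hb⟩
    rw [← this]
    exact Ideal.mul_mem_right _ _ (Ideal.subset_span ⟨⟨x, hQ hx⟩, hx, rfl⟩)
  · rintro b c ⟨hb, hb'⟩ ⟨hc, hc'⟩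
    refine ⟨add_mem hb hc, ?_⟩
    have := cls_add π (n + 1) ⟨b, hb⟩ ⟨c, hc⟩
    have h := add_mem hb' hc'
    rw [← this] at h
    exact h

include hπ hker in
-- This is the dictionary between forms and elements: questions about quotients of G(I) and F(I)
-- become questions about ideals of A.
theorem mem_formIdeal_iff {Q : Ideal A} (hQ : Q ≤ I) {n : ℕ} (a : ↥(I ^ n)) :
    cls π n a ∈ formIdeal π Q ↔ (a : A) ∈ stage I J Q n := by
  refine ⟨mem_stage_of_cls_mem hπ hker, fun h => ?_⟩
  obtain ⟨a, ha⟩ := a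
  cases n with
  | zero =>
    obtain ⟨_, h'⟩ := exists_cls_eq_zero_of_mem_mul hker (n := 0) (b := a)
      (by simpa [stage] using h)
    rw [h']
    exact zero_mem _
  | succ n =>
    obtain ⟨b, hb, c, hc, rfl⟩ := Submodule.mem_sup.mp h
    obtain ⟨hb1, hb2⟩ := exists_cls_eq_zero_of_mem_mul hker hb
    obtain ⟨hc1, hc2⟩ := exists_cls_mem_of_mem_mul (π := π) hQ hc
    have := cls_add π (n + 1) ⟨b, hb1⟩ ⟨c, hc1⟩
    rw [hb2, zero_add] at this
    rw [← this] at hc2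
    exact hc2

variable (π) in
theorem formIdeal_bot : formIdeal π (⊥ : Ideal A) = ⊥ := by
  rw [formIdeal, Ideal.span_eq_bot]
  rintro _ ⟨x, hx, rfl⟩
  rw [show x = 0 from Subtype.ext hx, linForm_zero]

include hπ hker in
theorem cls_eq_zero_iff {n : ℕ} (a : ↥(I ^ n)) : cls π n a = 0 ↔ (a : A) ∈ J * I ^ n := by
  rw [← Ideal.mem_bot, ← formIdeal_bot π, mem_formIdeal_iff hπ hker bot_le]
  cases n <;> simp [stage]

include hπ hker in
theorem isInternal_piece : DirectSum.IsInternal (piece π) := by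
  classical
  constructor
  · rw [injective_iff_map_eq_zero]
    intro x hx
    choose a ha using fun i => (mem_piece π).mp (x i).2
    rw [DirectSum.coeAddMonoidHom_eq_dfinsuppSum, DFinsupp.sum] at hx
    have h1 : π (∑ i ∈ DFinsupp.support x, reesMonomial i (a i)) = 0 := by
      rw [map_sum, ← hx]
      exact Finset.sum_congr rfl fun i _ => ha i
    rw [← RingHom.mem_ker, hker] at h1
    refine DFinsupp.ext fun i => Subtype.ext ?_
    rw [DFinsupp.zero_apply, AddSubgroup.coe_zero]
    by_cases hi : i ∈ DFinsupp.support x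
    · have h3 := map_le_stageIdeal J ⊥ h1 i
      rw [AddSubmonoidClass.coe_finsetSum, Polynomial.finsetSum_coeff] at h3
      simp only [coeff_reesMonomial] at h3
      rw [Finset.sum_ite_eq' (DFinsupp.support x) i, if_pos hi] at h3
      refine (ha i).symm.trans ((cls_eq_zero_iff hπ hker _).mpr ?_)
      cases i <;> simpa [stage] using h3
    · rw [DFinsupp.notMem_support_iff.mp hi]
      rfl
  · intro z
    obtain ⟨p, rfl⟩ := hπ z
    change _ ∈ (DirectSum.coeAddMonoidHom (piece π)).range
    have hp : p = ∑ i ∈ (p : Polynomial A).support,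
        reesMonomial i ⟨(p : Polynomial A).coeff i, p.2 i⟩ := by
      apply Subtype.ext
      rw [AddSubmonoidClass.coe_finsetSum]
      exact Polynomial.as_sum_support _
    rw [hp, map_sum]
    exact sum_mem fun i _ =>
      ⟨DirectSum.of (fun i => piece π i) i ⟨_, cls_mem π i _⟩, DirectSum.coeAddMonoidHom_of _ _ _⟩

include hπ hker in
/-- The quotient of the Rees algebra by the extension of an ideal of `A` is graded. -/
@[reducible]
def gradedRingPiece : GradedRing (piece π) where
  one_mem := (mem_piece π).mpr ⟨⟨1, by simp⟩, map_one π⟩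
  mul_mem i j x y hx hy := by
    obtain ⟨a, rfl⟩ := (mem_piece π).mp hx
    obtain ⟨b, rfl⟩ := (mem_piece π).mp hy
    rw [cls_mul_cls]
    exact cls_mem π _ _
  toDecomposition := (isInternal_piece hπ hker).chooseDecomposition

include hπ hker in
theorem irrelevantIdeal_eq_formIdeal :
    irrelevantIdeal (piece π) = formIdeal π I := by
  apply le_antisymm
  · rw [irrelevantIdeal, Ideal.span_le]
    rintro z ⟨n, hn, hz⟩
    obtain ⟨a, rfl⟩ := (mem_piece π).mp hz
    obtain ⟨m, rfl⟩ : ∃ m, n = m + 1 := ⟨n - 1, by omega⟩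
    refine (mem_formIdeal_iff hπ hker le_rfl a).mpr (Ideal.mem_sup_right ?_)
    rw [← pow_succ']
    exact a.2
  · rw [formIdeal, Ideal.span_le]
    rintro _ ⟨x, -, rfl⟩
    exact Ideal.subset_span ⟨1, one_pos, linForm_mem π x⟩

variable (π) in
theorem linForm_mem_irrelevantIdeal (x : I) :
    linForm π x ∈ irrelevantIdeal (piece π) :=
  Ideal.subset_span ⟨1, one_pos, linForm_mem π x⟩

include hπ hker in
theorem exists_isStandardGenerators [IsNoetherianRing A] :
    ∃ (r : ℕ) (f : Fin r → S), IsStandardGenerators (piece π) f := by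
  obtain ⟨r, g, hg⟩ := Submodule.fg_iff_exists_fin_generating_family.mp
    (IsNoetherian.noetherian (⊤ : Submodule A I))
  refine ⟨r, fun i => linForm π (g i), fun i => linForm_mem π _, le_antisymm ?_ ?_⟩
  · rw [Ideal.span_le]
    rintro _ ⟨i, rfl⟩
    exact linForm_mem_irrelevantIdeal π _
  · rw [irrelevantIdeal_eq_formIdeal hπ hker, formIdeal, Ideal.span_le]
    rintro _ ⟨x, -, rfl⟩
    have hx : x ∈ Submodule.span A (Set.range g) := hg ▸ Submodule.mem_top
    induction hx using Submodule.span_induction with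
    | mem x hx =>
      obtain ⟨i, rfl⟩ := hx
      exact Ideal.subset_span ⟨i, rfl⟩
    | zero =>
      rw [linForm_zero]
      exact zero_mem _
    | add x y _ _ hx hy =>
      rw [linForm_add]
      exact add_mem hx hy
    | smul c x _ hx =>
      rw [linForm_smul]
      exact Ideal.mul_mem_left _ _ hx

variable (π) in
theorem formIdeal_sup_span {Q : Ideal A} (hQ : Q ≤ I) (x : I) :
    formIdeal π (Q ⊔ Ideal.span {(x : A)}) = formIdeal π Q ⊔ Ideal.span {linForm π x} := by
  apply le_antisymm
  · rw [formIdeal, Ideal.span_le]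
    rintro _ ⟨y, hy, rfl⟩
    obtain ⟨q, hq, t, ht, hqt⟩ := Submodule.mem_sup.mp hy
    obtain ⟨c, rfl⟩ := Ideal.mem_span_singleton'.mp ht
    have : y = ⟨q, hQ hq⟩ + c • x := Subtype.ext hqt.symm
    rw [this, linForm_add, linForm_smul]
    exact add_mem (Ideal.mem_sup_left (Ideal.subset_span ⟨⟨q, hQ hq⟩, hq, rfl⟩))
      (Ideal.mem_sup_right (Ideal.mul_mem_left _ _ (Ideal.mem_span_singleton_self _)))
  · refine sup_le (Ideal.span_mono (Set.image_mono fun y hy => Ideal.mem_sup_left hy)) ?_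
    rw [Ideal.span_singleton_le_iff_mem]
    exact Ideal.subset_span ⟨x, Ideal.mem_sup_right (Ideal.mem_span_singleton_self _), rfl⟩

/-- A chain in `A` by elements of `I` induces a chain of linear forms. -/
theorem Chain.formIdeal {P : Ideal A → A → Prop}
    {P' : Ideal S → S → Prop} (hI : ∀ Q x, P Q x → x ∈ I)
    (h : ∀ Q, Q ≤ I → ∀ x : I, P Q x → P' (FiberConeReg.formIdeal π Q) (linForm π x))
    {n : ℕ}
    {Q : Ideal A} (hQ : Chain P n Q) : Chain P' n (FiberConeReg.formIdeal π Q) ∧ Q ≤ I := by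
  induction hQ with
  | nil =>
    rw [formIdeal_bot]
    exact ⟨.nil, bot_le⟩
  | @snoc n Q x _ hx ih =>
    have hxI := hI _ _ hx
    refine ⟨?_, sup_le ih.2 ((Ideal.span_singleton_le_iff_mem I).mpr hxI)⟩
    rw [formIdeal_sup_span π ih.2 ⟨x, hxI⟩]
    exact .snoc ih.1 (h Q ih.2 ⟨x, hxI⟩ hx)

end Rees

end FiberConeReg

end

noncomputable section

namespace FiberConeReg

/-! ### Sequences of elements of `I` and their leading forms -/

section LeadingForms

variable {A : Type*} [CommRing A] {I : Ideal A}

/-- The element a climbs the filtration modulo Q. If a ≡ z with z ∈ I^k and k + 2 ≤ N, then `hQ`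
puts x z in I^(k+2) + Q I^k, and regularity of the form of x pushes z into I^(k+1) + Q. -/
theorem mem_pow_sup_of_leading_form {Q : Ideal A} {x : A} (hxI : x ∈ I)
    (hx : ∀ n, ∀ a ∈ I ^ n, x * a ∈ stage I I Q (n + 1) → a ∈ stage I I Q n)
    (hQ : ∀ n, Q ⊓ I ^ (n + 1) ≤ Q * I ^ n) {N : ℕ} {u a : A} (hu : u ∈ I ^ N)
    (hua : u - x * a ∈ Q) {k : ℕ} (hk : k + 1 ≤ N) : a ∈ I ^ k ⊔ Q := by
  induction k with
  | zero => simp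
  | succ k ih =>
    obtain ⟨z, hz, q, hq, rfl⟩ := Submodule.mem_sup.mp (ih (by omega))
    have h1 : u - x * z ∈ Q := by
      rw [show u - x * z = (u - x * (z + q)) + x * q by ring]
      exact add_mem hua (Q.mul_mem_left _ hq)
    have h2 : x * z ∈ I ^ (k + 1) := by
      rw [pow_succ']
      exact Ideal.mul_mem_mul hxI hz
    have h3 := hQ k ⟨h1, sub_mem (Ideal.pow_le_pow_right (by omega) hu) h2⟩
    have h4 : x * z ∈ stage I I Q (k + 1) := by
      rw [show x * z = u - (u - x * z) by ring]
      refine sub_mem (Ideal.mem_sup_left ?_) (Ideal.mem_sup_right h3)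
      rw [← pow_succ']
      exact Ideal.pow_le_pow_right hk hu
    have h5 := hx k z hz h4
    refine add_mem ?_ (Ideal.mem_sup_right hq)
    cases k with
    | zero => exact Ideal.mem_sup_left (by simpa [stage] using h5)
    | succ k =>
      have : stage I I Q (k + 1) ≤ I ^ (k + 1 + 1) ⊔ Q :=
        sup_le_sup (pow_succ' I (k + 1)).ge Ideal.mul_le_left
      exact this h5

/-- An initial regular form preserves the Valabrega–Valla condition. -/
theorem inf_pow_le_of_leading_form {Q : Ideal A} {x : A} (hxI : x ∈ I)
    (hx : ∀ n, ∀ a ∈ I ^ n, x * a ∈ stage I I Q (n + 1) → a ∈ stage I I Q n)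
    (hQ : ∀ n, Q ⊓ I ^ (n + 1) ≤ Q * I ^ n) (n : ℕ) :
    (Q ⊔ Ideal.span {x}) ⊓ I ^ (n + 1) ≤ (Q ⊔ Ideal.span {x}) * I ^ n := by
  rintro u ⟨hu, huI⟩
  obtain ⟨a, ha⟩ := mem_sup_span_iff.mp hu
  obtain ⟨z, hz, q, hq, rfl⟩ := Submodule.mem_sup.mp
    (mem_pow_sup_of_leading_form hxI hx hQ huI ha le_rfl)
  have h1 : u - x * z ∈ Q := by
    rw [show u - x * z = (u - x * (z + q)) + x * q by ring]
    exact add_mem ha (Q.mul_mem_left _ hq)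
  have h2 : x * z ∈ I ^ (n + 1) := by
    rw [pow_succ']
    exact Ideal.mul_mem_mul hxI hz
  have h3 := hQ n ⟨h1, sub_mem huI h2⟩
  rw [Ideal.sup_mul, ← sub_add_cancel u (x * z)]
  exact add_mem (Ideal.mem_sup_left h3)
    (Ideal.mem_sup_right (Ideal.mul_mem_mul (Ideal.mem_span_singleton_self x) hz))

/-- Taking u = 0, the climb never stops, so a ∈ I^k + Q for all k; Krull's intersection theorem
gives a ∈ Q. -/
theorem regularMod_of_leading_form [IsNoetherianRing A] [IsLocalRing A] (hI : I ≠ ⊤)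
    {Q : Ideal A} {x : A} (hxI : x ∈ I)
    (hx : ∀ n, ∀ a ∈ I ^ n, x * a ∈ stage I I Q (n + 1) → a ∈ stage I I Q n)
    (hQ : ∀ n, Q ⊓ I ^ (n + 1) ≤ Q * I ^ n) : RegularMod Q x := by
  intro a ha
  have h1 : (Submodule.Quotient.mk a : A ⧸ Q) ∈ (⨅ i : ℕ, I ^ i • ⊤ : Submodule A (A ⧸ Q)) := by
    rw [Submodule.mem_iInf]
    intro k
    obtain ⟨z, hz, q, hq, rfl⟩ := Submodule.mem_sup.mp
      (mem_pow_sup_of_leading_form hxI hx hQ (u := 0) (N := k + 1) (a := a) (zero_mem _)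
        (by rw [zero_sub]; exact neg_mem ha) le_rfl)
    rw [Submodule.Quotient.mk_add, (Submodule.Quotient.mk_eq_zero Q).mpr hq, add_zero,
      show (Submodule.Quotient.mk z : A ⧸ Q) = z • Submodule.Quotient.mk 1 by
        rw [← Submodule.Quotient.mk_smul, smul_eq_mul, mul_one]]
    exact Submodule.smul_mem_smul hz trivial
  rw [Ideal.iInf_pow_smul_eq_bot_of_isLocalRing I hI] at h1
  exact (Submodule.Quotient.mk_eq_zero Q).mp h1

/-- Nakayama absorbs the summand J I^(n+1). -/
theorem pow_le_of_pow_le_stage [IsNoetherianRing A] [IsLocalRing A] {J Q : Ideal A}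
    (hJ : J ≤ IsLocalRing.maximalIdeal A) {n : ℕ} (h : I ^ (n + 1) ≤ stage I J Q (n + 1)) :
    I ^ (n + 1) ≤ Q * I ^ n := by
  refine Submodule.le_of_le_smul_of_le_jacobson_bot (I := J) (IsNoetherian.noetherian _)
    (hJ.trans (IsLocalRing.maximalIdeal_le_jacobson _)) ?_
  rw [sup_comm]
  exact h

/-- If `x` is regular modulo `Q` and `Iᵈ⁺¹ = (Q, x) Iᵈ`, then `x t` acts injectively in degree
`d` on `⨁ₙ Iⁿ / J Iⁿ` modulo the forms from `Q`. -/
theorem mem_stage_of_mul_mem_stage {J Q : Ideal A} {x : A} (hreg : RegularMod Q x)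
    (hQ : ∀ n, Q ⊓ I ^ (n + 1) ≤ Q * I ^ n) {d : ℕ}
    (hd : I ^ (d + 1 + 1) ≤ (Q ⊔ Ideal.span {x}) * I ^ (d + 1)) {a : A} (ha : a ∈ I ^ (d + 1))
    (h : x * a ∈ stage I J Q (d + 1 + 1)) : a ∈ stage I J Q (d + 1) := by
  -- The reduction equation exposes a factor x modulo Q. Cancelling it leaves a - w ∈ Q ∩ I^(d+1)
  -- with w ∈ J I^(d+1), and `hQ` finishes.
  have h1 : stage I J Q (d + 1 + 1) ≤ Q ⊔ Ideal.span {x} * (J * I ^ (d + 1)) := by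
    refine sup_le ?_ (Ideal.mul_le_left.trans le_sup_left)
    calc J * I ^ (d + 1 + 1) ≤ J * ((Q ⊔ Ideal.span {x}) * I ^ (d + 1)) := Ideal.mul_mono_right hd
      _ = Q * (J * I ^ (d + 1)) ⊔ Ideal.span {x} * (J * I ^ (d + 1)) := by
        rw [mul_left_comm, Ideal.sup_mul]
      _ ≤ Q ⊔ Ideal.span {x} * (J * I ^ (d + 1)) := sup_le_sup_right Ideal.mul_le_left _
  obtain ⟨q, hq, t, ht, hqt⟩ := Submodule.mem_sup.mp (h1 h)
  obtain ⟨w, hw, rfl⟩ := Ideal.mem_span_singleton_mul.mp ht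
  have h2 : a - w ∈ Q := by
    refine hreg _ ?_
    rw [mul_sub, ← hqt, add_sub_cancel_right]
    exact hq
  have h3 := hQ d ⟨h2, sub_mem ha (Ideal.mul_le_right hw)⟩
  rw [← sub_add_cancel a w]
  exact add_mem (Ideal.mem_sup_right h3) (Ideal.mem_sup_left hw)

end LeadingForms

/-! ### Generic linear forms and reductions -/

section Forms

variable {A : Type*} [CommRing A] {I J : Ideal A} {S : Type*} [CommRing S]
  {π : reesAlgebra I →+* S} (hπ : Function.Surjective π)
  (hker : RingHom.ker π = J.map (algebraMap A (reesAlgebra I)))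

include hπ hker in
theorem mem_stage_of_regularMod {Q : Ideal A} (hQ : Q ≤ I) {x : I}
    (h : RegularMod (formIdeal π Q) (linForm π x)) (n : ℕ) (a : A) (ha : a ∈ I ^ n)
    (hxa : x * a ∈ stage I J Q (n + 1)) : a ∈ stage I J Q n := by
  refine (mem_formIdeal_iff hπ hker hQ ⟨a, ha⟩).mp (h _ ?_)
  rw [linForm_mul_cls]
  exact (mem_formIdeal_iff hπ hker hQ _).mpr hxa

include hπ hker in
/-- Avoiding finitely many ideals not containing `I` makes a linear form regular modulo an ideal
of depth at least one. -/
theorem exists_finite_avoid [IsNoetherianRing S] {K : Ideal S}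
    (hK : ColonEq (irrelevantIdeal (piece π)) K) :
    ∃ T : Set (Ideal A), T.Finite ∧ (∀ N ∈ T, ¬ I ≤ N) ∧
      ∀ x : I, (∀ N ∈ T, (x : A) ∉ N) → RegularMod K (linForm π x) := by
  -- `N P` consists of the a ∈ I with a t ∈ P. It contains I only if S₊ ⊆ P, which is impossible for
  -- an associated prime of S / K.
  let N (P : Ideal S) : Ideal A :=
    { carrier := {a | ∃ h : a ∈ I, linForm π ⟨a, h⟩ ∈ P}
      add_mem' := by
        rintro a b ⟨ha, ha'⟩ ⟨hb, hb'⟩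
        refine ⟨add_mem ha hb, ?_⟩
        have := linForm_add π ⟨a, ha⟩ ⟨b, hb⟩
        have h := add_mem ha' hb'
        rw [← this] at h
        exact h
      zero_mem' := ⟨zero_mem _, by
        have := linForm_zero π
        exact (show linForm π ⟨0, zero_mem I⟩ = 0 from this) ▸ zero_mem _⟩
      smul_mem' := by
        rintro c a ⟨ha, ha'⟩
        refine ⟨I.mul_mem_left c ha, ?_⟩
        have := linForm_smul π c ⟨a, ha⟩
        have h := P.mul_mem_left (π (algebraMap A (reesAlgebra I) c)) ha'
        rw [← this] at h
        exact h }
  refine ⟨N '' associatedPrimes S (S ⧸ K), (associatedPrimes.finite S (S ⧸ K)).image N, ?_, ?_⟩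
  · rintro _ ⟨P, hP, rfl⟩ hle
    refine hK.not_le hP ?_
    rw [irrelevantIdeal_eq_formIdeal hπ hker, formIdeal, Ideal.span_le]
    rintro _ ⟨x, -, rfl⟩
    obtain ⟨_, h⟩ := hle x.2
    exact h
  · intro x hx
    refine regularMod_of_forall_notMem fun P hP hxP => ?_
    exact hx _ ⟨P, hP, rfl⟩ ⟨x.2, hxP⟩

variable (π) in
theorem cls_mem_irrelevantIdeal_pow (n : ℕ) {a : A} (ha : a ∈ I ^ n) :
    cls π n ⟨a, ha⟩ ∈ irrelevantIdeal (piece π) ^ n := by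
  induction n generalizing a with
  | zero => simp
  | succ n ih =>
    suffices ∃ h : a ∈ I ^ (n + 1), cls π (n + 1) ⟨a, h⟩ ∈ irrelevantIdeal (piece π) ^ (n + 1) from
      this.2
    have ha' := ha
    rw [pow_succ'] at ha'
    refine Submodule.mul_induction_on ha' (fun x hx b hb => ?_) ?_
    · refine ⟨by rw [pow_succ']; exact Ideal.mul_mem_mul hx hb, ?_⟩
      have := linForm_mul_cls π ⟨x, hx⟩ ⟨b, hb⟩
      rw [← this, pow_succ']
      exact Ideal.mul_mem_mul (linForm_mem_irrelevantIdeal π _) (ih hb)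
    · rintro b c ⟨hb, hb'⟩ ⟨hc, hc'⟩
      refine ⟨add_mem hb hc, ?_⟩
      have := cls_add π (n + 1) ⟨b, hb⟩ ⟨c, hc⟩
      have h := add_mem hb' hc'
      rw [← this] at h
      exact h

include hπ hker in
/-- If `S₊` is nilpotent modulo the forms from `Q`, then `Q` is a reduction of `I`. -/
theorem exists_pow_le_mul_pow [IsNoetherianRing A] [IsLocalRing A]
    (hJ : J ≤ IsLocalRing.maximalIdeal A) {Q : Ideal A} (hQ : Q ≤ I)
    (h : ∃ N : ℕ, irrelevantIdeal (piece π) ^ N ≤ formIdeal π Q) :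
    ∃ n : ℕ, I ^ (n + 1) ≤ Q * I ^ n := by
  obtain ⟨N, hN⟩ := h
  refine ⟨N, pow_le_of_pow_le_stage hJ fun a ha => ?_⟩
  refine (mem_formIdeal_iff hπ hker hQ ⟨a, ha⟩).mp (hN ?_)
  exact Ideal.pow_le_pow_right (Nat.le_succ N)
    (cls_mem_irrelevantIdeal_pow π (N + 1) ha)

theorem mul_pow_le_of_le {Q : Ideal A} {r : ℕ} (h : I ^ (r + 1) ≤ Q * I ^ r) {n : ℕ} (hn : r ≤ n) :
    I ^ (n + 1) ≤ Q * I ^ n := by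
  obtain ⟨k, rfl⟩ := Nat.exists_eq_add_of_le hn
  calc I ^ (r + k + 1) = I ^ (r + 1) * I ^ k := by ring
    _ ≤ Q * I ^ r * I ^ k := Ideal.mul_mono_left h
    _ = Q * I ^ (r + k) := by ring

include hπ hker in
theorem mem_formIdeal_of_lt {Q : Ideal A} (hQ : Q ≤ I) {r : ℕ} (h : I ^ (r + 1) ≤ Q * I ^ r)
    (d : ℕ) (hd : r < d) (z : S) (hz : z ∈ piece π d) : z ∈ formIdeal π Q := by
  obtain ⟨a, rfl⟩ := (mem_piece π).mp hz
  obtain ⟨d, rfl⟩ : ∃ e, d = e + 1 := ⟨d - 1, by omega⟩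
  exact (mem_formIdeal_iff hπ hker hQ a).mpr
    (Ideal.mem_sup_right (mul_pow_le_of_le h (by omega) a.2))

include hπ hker in
-- If degree r vanished modulo the forms, Nakayama would give the reduction equation already for r -
-- 1; for r = 0 it would put 1 in J.
theorem exists_notMem_formIdeal [IsNoetherianRing A] [IsLocalRing A]
    (hJ : J ≤ IsLocalRing.maximalIdeal A) {Q : Ideal A} (hQ : Q ≤ I) {r : ℕ}
    (hmin : ∀ m < r, ¬ I ^ (m + 1) ≤ Q * I ^ m) : ∃ z ∈ piece π r, z ∉ formIdeal π Q := by
  by_contra! hcon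
  have h1 : I ^ r ≤ stage I J Q r := fun a ha =>
    (mem_formIdeal_iff hπ hker hQ ⟨a, ha⟩).mp (hcon _ (cls_mem π r ⟨a, ha⟩))
  cases r with
  | zero =>
    have h2 : (1 : A) ∈ J := h1 (by simp)
    exact (Ideal.ne_top_iff_one _).mp (IsLocalRing.maximalIdeal.isMaximal A).ne_top (hJ h2)
  | succ r => exact hmin r (Nat.lt_succ_self r) (pow_le_of_pow_le_stage hJ h1)

include hπ hker in
theorem isInjectiveForm_linForm {Q : Ideal A} (hQI : Q ≤ I) {x : I} (hreg : RegularMod Q (x : A))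
    (hQ : ∀ n, Q ⊓ I ^ (n + 1) ≤ Q * I ^ n) {r : ℕ}
    (h : I ^ (r + 1) ≤ (Q ⊔ Ideal.span {(x : A)}) * I ^ r) :
    IsInjectiveForm (piece π) r (formIdeal π Q) (linForm π x) := by
  refine ⟨linForm_mem π x, fun d hd z hz hxz => ?_⟩
  obtain ⟨a, rfl⟩ := (mem_piece π).mp hz
  obtain ⟨d, rfl⟩ : ∃ e, d = e + 1 := ⟨d - 1, by omega⟩
  rw [linForm_mul_cls] at hxz
  have hxz := (mem_formIdeal_iff hπ hker hQI _).mp hxz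
  exact (mem_formIdeal_iff hπ hker hQI a).mpr
    (mem_stage_of_mul_mem_stage hreg hQ (mul_pow_le_of_le h (by omega)) a.2 hxz)

variable (π) in
theorem isTorsionForm_of_filterRegularMod {K : Ideal S} {x : I}
    (h : FilterRegularMod (irrelevantIdeal (piece π)) K (linForm π x)) :
    IsTorsionForm (piece π) K (linForm π x) := by
  obtain ⟨N, hN⟩ := h.exists_pow_mul_mem
  refine ⟨linForm_mem π x, fun d z _ hxz y hy => ⟨N, hN z hxz _ (Ideal.pow_mem_pow ?_ N)⟩⟩
  exact Ideal.subset_span ⟨1, one_pos, hy⟩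

variable (π) in
theorem isInjectiveForm_of_regularMod (r : ℕ) {K : Ideal S} {x : I}
    (h : RegularMod K (linForm π x)) : IsInjectiveForm (piece π) r K (linForm π x) :=
  ⟨linForm_mem π x, fun _ _ z _ hz => h z hz⟩

end Forms

end FiberConeReg

end

noncomputable section

namespace FiberConeReg

/-! ### Comparison of the regularities -/

section Comparison

variable {A : Type*} [CommRing A] {I : Ideal A}
variable {G F : Type*} [CommRing G] [CommRing F]
variable {πG : reesAlgebra I →+* G} {πF : reesAlgebra I →+* F}

variable (πG πF) in
/-- The form of `x ∈ I` is regular on `G` and filter-regular on `F` modulo the forms from `Q`. -/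
def IsGenericElement (Q : Ideal A) (x : A) : Prop :=
  ∃ h : x ∈ I, RegularMod (formIdeal πG Q) (linForm πG ⟨x, h⟩) ∧
    FilterRegularMod (irrelevantIdeal (piece πF)) (formIdeal πF Q) (linForm πF ⟨x, h⟩)

theorem chain_filterRegularMod {n : ℕ} {Q : Ideal A} (hQ : Chain (IsGenericElement πG πF) n Q) :
    Chain (fun K y => y ∈ Set.range (linForm πF) ∧
      FilterRegularMod (irrelevantIdeal (piece πF)) K y) n (formIdeal πF Q) :=
  (hQ.formIdeal (π := πF) (fun _ _ h => h.1) fun _ _ x h => ⟨⟨x, rfl⟩, h.2.2⟩).1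

theorem chain_regularMod {n : ℕ} {Q : Ideal A} (hQ : Chain (IsGenericElement πG πF) n Q) :
    Chain (fun K y => y ∈ Set.range (linForm πG) ∧ RegularMod K y) n (formIdeal πG Q) ∧ Q ≤ I :=
  hQ.formIdeal (π := πG) (fun _ _ h => h.1) fun _ _ x h => ⟨⟨x, rfl⟩, h.2.1⟩

/-- If `F₊` contains a long regular sequence, filter-regular sequences of linear forms are
regular. -/
theorem Chain.regularMod_of_filterRegularMod [IsNoetherianRing F] {g n : ℕ} {K : Ideal F}
    (hg : HasRegSeq (irrelevantIdeal (piece πF)) g ⊥)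
    (hK : Chain (fun K y => y ∈ Set.range (linForm πF) ∧
      FilterRegularMod (irrelevantIdeal (piece πF)) K y) n K) (hn : n ≤ g) :
    Chain (fun K y => y ∈ Set.range (linForm πF) ∧ RegularMod K y) n K := by
  induction hK with
  | nil => exact .nil
  | @snoc n K y _ hy ih =>
    have h1 := ih (by omega)
    have h2 := hg.of_chain (fun Q x hx => ⟨by
      obtain ⟨⟨x, rfl⟩, -⟩ := hx
      exact linForm_mem_irrelevantIdeal πF x, hx.2⟩) h1 (by omega)
    rw [show g - n = g - (n + 1) + 1 by omega] at h2
    exact .snoc h1 ⟨hy.1, hy.2.regularMod h2.colonEq⟩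

/-- The last element of a reduction is regular if the grade of `I` is large enough. -/
theorem regularMod_of_hasRegSeq {Q : Ideal A} {x : A} (hQ : HasRegSeq I 1 Q) {r : ℕ}
    (h : I ^ (r + 1) ≤ (Q ⊔ Ideal.span {x}) * I ^ r) : RegularMod Q x := by
  obtain ⟨b, hbI, hb, -⟩ := hQ
  intro z hz
  -- Modulo Q a power of the regular element b is a multiple of x, so whatever x kills is killed by
  -- that power.
  obtain ⟨c, hc⟩ := mem_sup_span_iff.mp
    (Ideal.mul_le_left (h (Ideal.pow_mem_pow hbI (r + 1))) : b ^ (r + 1) ∈ Q ⊔ Ideal.span {x})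
  have h1 : b ^ (r + 1) * z ∈ Q := by
    rw [show b ^ (r + 1) * z = (b ^ (r + 1) - x * c) * z + c * (x * z) by ring]
    exact add_mem (Q.mul_mem_right _ hc) (Q.mul_mem_left _ hz)
  have key : ∀ k : ℕ, b ^ k * z ∈ Q → z ∈ Q := by
    intro k
    induction k with
    | zero => simp
    | succ k ih =>
      intro h
      rw [pow_succ', mul_assoc] at h
      exact ih (hb _ h)
  exact key _ h1

variable [IsLocalRing A]
variable (hπG : Function.Surjective πG)
  (hkerG : RingHom.ker πG = I.map (algebraMap A (reesAlgebra I)))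
  (hπF : Function.Surjective πF)
  (hkerF : RingHom.ker πF = (IsLocalRing.maximalIdeal A).map (algebraMap A (reesAlgebra I)))

include hπF hkerF in
-- No depth is required: the avoidance is applied to the saturation of the form ideal.
theorem exists_filterRegularMod [IsNoetherianRing F] (Q : Ideal A) :
    ∃ T : Set (Ideal A), T.Finite ∧ (∀ N ∈ T, ¬ I ≤ N) ∧ ∀ x : I, (∀ N ∈ T, (x : A) ∉ N) →
      FilterRegularMod (irrelevantIdeal (piece πF)) (formIdeal πF Q) (linForm πF x) := by
  obtain ⟨N, hN⟩ := exists_colonEq_colon_pow (irrelevantIdeal (piece πF)) (formIdeal πF Q)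
  obtain ⟨T, hT, hT', h⟩ := exists_finite_avoid hπF hkerF hN
  exact ⟨T, hT, hT', fun x hx => ⟨N, h x hx⟩⟩

include hπG hkerG hπF hkerF in
-- Both requirements amount to avoiding finitely many ideals not containing I, so one x meets them
-- together, as long as the quotient of G retains positive grade.
theorem exists_chain_isGenericElement [Infinite (IsLocalRing.ResidueField A)]
    [IsNoetherianRing G] [IsNoetherianRing F] {g : ℕ}
    (hg : HasRegSeq (irrelevantIdeal (piece πG)) g ⊥) (n : ℕ) (hn : n ≤ g) :
    ∃ Q : Ideal A, Chain (IsGenericElement πG πF) n Q := by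
  induction n with
  | zero => exact ⟨⊥, .nil⟩
  | succ n ih =>
    obtain ⟨Q, hQ⟩ := ih (by omega)
    have h2 := hg.of_chain (fun Q x hx => ⟨by
      obtain ⟨⟨x, rfl⟩, -⟩ := hx
      exact linForm_mem_irrelevantIdeal πG x, hx.2⟩) (chain_regularMod hQ).1 (by omega)
    rw [show g - n = g - (n + 1) + 1 by omega] at h2
    obtain ⟨T, hT, hT', hreg⟩ := exists_finite_avoid hπG hkerG h2.colonEq
    obtain ⟨U, hU, hU', hfil⟩ := exists_filterRegularMod hπF hkerF Q
    obtain ⟨x, hx, hxT⟩ := exists_mem_forall_notMem I (hT.union hU) (by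
      rintro N (hN | hN)
      · exact hT' N hN
      · exact hU' N hN)
    exact ⟨_, hQ.snoc ⟨hx, hreg ⟨x, hx⟩ fun N hN => hxT N (Or.inl hN),
      hfil ⟨x, hx⟩ fun N hN => hxT N (Or.inr hN)⟩⟩

variable [IsNoetherianRing A]

include hπG hkerG in
theorem inf_pow_le_and_chain_of_chain (hI : I ≠ ⊤) {n : ℕ} {Q : Ideal A}
    (hQ : Chain (IsGenericElement πG πF) n Q) :
    (∀ n, Q ⊓ I ^ (n + 1) ≤ Q * I ^ n) ∧ Chain (fun Q x => x ∈ I ∧ RegularMod Q x) n Q := by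
  induction hQ with
  | nil => exact ⟨fun n => by simp, .nil⟩
  | @snoc n Q x hQ hx ih =>
    obtain ⟨hxI, hreg, -⟩ := hx
    have h1 := mem_stage_of_regularMod hπG hkerG (chain_regularMod hQ).2 hreg
    exact ⟨inf_pow_le_of_leading_form hxI h1 ih.1,
      ih.2.snoc ⟨hxI, regularMod_of_leading_form hI hxI h1 ih.1⟩⟩

include hπG hkerG hπF hkerF in
-- The witness is the reduction number of a generic l-generated reduction; both regularities are
-- compared with it.
theorem exists_reg_eq [Infinite (IsLocalRing.ResidueField A)] (hI : I ≠ ⊤) {l : ℕ} (hl : 0 < l)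
    (hdim : ringKrullDim F = (l : WithBot ℕ∞)) (hgrade : HasRegSeq I l ⊥)
    (hG : HasRegSeq (irrelevantIdeal (piece πG)) (l - 1) ⊥) :
    ∃ r : WithBot (WithTop ℤ), reg (piece πG) (piece πG) = r ∧ r ≤ reg (piece πF) (piece πF) ∧
      (HasRegSeq (irrelevantIdeal (piece πF)) (l - 1) ⊥ → reg (piece πF) (piece πF) ≤ r) := by
  have : IsNoetherianRing G := isNoetherianRing_of_surjective _ _ πG hπG
  have : IsNoetherianRing F := isNoetherianRing_of_surjective _ _ πF hπF
  let _ := gradedRingPiece hπG hkerG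
  let _ := gradedRingPiece hπF hkerF
  have hIm := IsLocalRing.le_maximalIdeal hI
  obtain ⟨g, rfl⟩ : ∃ g, l = g + 1 := ⟨l - 1, by omega⟩
  rw [Nat.add_sub_cancel] at hG ⊢
  obtain ⟨Q, hQ⟩ := exists_chain_isGenericElement hπG hkerG hπF hkerF hG g le_rfl
  obtain ⟨hGchain, hQI⟩ := chain_regularMod hQ
  have hFchain := chain_filterRegularMod hQ
  obtain ⟨hVV, hAchain⟩ := inf_pow_le_and_chain_of_chain hπG hkerG hI hQ
  -- The last element is chosen for F alone, since the hypothesis on G provides only g regular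
  -- forms.
  obtain ⟨T, hT, hT', hfil⟩ := exists_filterRegularMod hπF hkerF Q
  obtain ⟨x, hxI, hxT⟩ := exists_mem_forall_notMem I hT hT'
  replace hfil := hfil ⟨x, hxI⟩ hxT
  have hQ'I : Q ⊔ Ideal.span {x} ≤ I := sup_le hQI ((Ideal.span_singleton_le_iff_mem I).mpr hxI)
  have hF' := hFchain.snoc ⟨⟨⟨x, hxI⟩, rfl⟩, hfil⟩
  rw [← formIdeal_sup_span πF hQI] at hF'
  have hred : ∃ n : ℕ, I ^ (n + 1) ≤ (Q ⊔ Ideal.span {x}) * I ^ n :=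
    exists_pow_le_mul_pow hπF hkerF le_rfl hQ'I
      (exists_irrelevantIdeal_pow_le (piece πF) hdim (hF'.mono fun _ _ h => h.2)
        (hF'.isHomogeneous (𝒜 := piece πF) fun K y h => by
          obtain ⟨⟨x, rfl⟩, -⟩ := h
          exact linForm_mem πF x))
  classical
  have hr := Nat.find_spec hred
  have hmin := fun m (hm : m < Nat.find hred) => Nat.find_min hred hm
  generalize Nat.find hred = r at hr hmin
  have hxreg : RegularMod Q x := by
    refine regularMod_of_hasRegSeq ?_ hr
    have := hgrade.of_chain (fun _ _ h => h) hAchain (Nat.le_succ g)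
    rwa [Nat.succ_sub le_rfl, Nat.sub_self] at this
  -- The first g forms are injective in every degree, the last one only in degrees above r.
  have hG' : Chain (IsInjectiveForm (piece πG) r) (g + 1) (formIdeal πG (Q ⊔ Ideal.span {x})) := by
    rw [formIdeal_sup_span πG hQI ⟨x, hxI⟩]
    refine .snoc (hGchain.mono fun K y h => ?_) (isInjectiveForm_linForm hπG hkerG hQI hxreg hVV hr)
    obtain ⟨⟨x, rfl⟩, h⟩ := h
    exact isInjectiveForm_of_regularMod πG r h
  have hGtop := mem_formIdeal_of_lt hπG hkerG hQ'I hr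
  have hFtop := mem_formIdeal_of_lt hπF hkerF hQ'I hr
  obtain ⟨zG, hzG, hzG'⟩ := exists_notMem_formIdeal hπG hkerG hIm hQ'I hmin
  obtain ⟨zF, hzF, hzF'⟩ := exists_notMem_formIdeal hπF hkerF le_rfl hQ'I hmin
  refine ⟨(((r : ℤ) : WithTop ℤ) : WithBot (WithTop ℤ)),
    le_antisymm (reg_le_of_chain hG' hGtop) ?_, ?_, fun hF => ?_⟩
  · exact le_reg_of_chain (exists_isStandardGenerators hπG hkerG)
      (hG'.mono fun _ _ h => h.isTorsionForm)
      (fun y hy => ⟨r + 1, hGtop _ (Nat.lt_succ_self r) _ (pow_mem_piece hy _)⟩) hzG hzG'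
  · refine le_reg_of_chain (exists_isStandardGenerators hπF hkerF)
      (hF'.mono fun K y h => ?_)
      (fun y hy => ⟨r + 1, hFtop _ (Nat.lt_succ_self r) _ (pow_mem_piece hy _)⟩) hzF hzF'
    obtain ⟨⟨x, rfl⟩, h⟩ := h
    exact isTorsionForm_of_filterRegularMod πF h
  · have hF'' : Chain (IsInjectiveForm (piece πF) r) (g + 1)
        (formIdeal πF (Q ⊔ Ideal.span {x})) := by
      rw [formIdeal_sup_span πF hQI ⟨x, hxI⟩]
      -- Only here does the depth of F enter: it upgrades the first g forms from filter-regular to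
      -- regular.
      refine .snoc ((hFchain.regularMod_of_filterRegularMod hF le_rfl).mono fun K y h => ?_)
        (isInjectiveForm_linForm hπF hkerF hQI hxreg hVV hr)
      obtain ⟨⟨x, rfl⟩, h⟩ := h
      exact isInjectiveForm_of_regularMod πF r h
    exact reg_le_of_chain hF'' hFtop

end Comparison

end FiberConeReg

end

/-! ### Specialisation to the associated graded ring and the fiber cone -/

noncomputable section

namespace FiberConeReg

open IsLocalRing

theorem reg_le_reg_and_eq {A G F : Type*} [CommRing A] [IsLocalRing A] [IsNoetherianRing A]
    [Infinite (ResidueField A)] {I : Ideal A} [CommRing G] [CommRing F]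
    {πG : reesAlgebra I →+* G} {πF : reesAlgebra I →+* F}
    (hπG : Function.Surjective πG)
    (hkerG : ∀ p, πG p = 0 ↔ p ∈ I.map (algebraMap A (reesAlgebra I)))
    (hπF : Function.Surjective πF)
    (hkerF : ∀ p, πF p = 0 ↔ p ∈ (maximalIdeal A).map (algebraMap A (reesAlgebra I)))
    {𝒢 : ℕ → AddSubgroup G} {ℱ : ℕ → AddSubgroup F} (h𝒢 : 𝒢 = piece πG) (hℱ : ℱ = piece πF)
    (hI : I ≠ ⊤) {l : ℕ} (hl : 0 < l) (hdim : ringKrullDim F = l) (hgrade : grade I = l)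
    (hG : ((l - 1 : ℕ) : ℕ∞) ≤ grade (irrelevantIdeal 𝒢)) :
    reg 𝒢 𝒢 ≤ reg ℱ ℱ ∧
      (((l - 1 : ℕ) : ℕ∞) ≤ grade (irrelevantIdeal ℱ) → reg ℱ ℱ = reg 𝒢 𝒢) := by
  subst h𝒢 hℱ
  obtain ⟨r, hr, hle, hge⟩ := exists_reg_eq hπG (Ideal.ext hkerG) hπF (Ideal.ext hkerF) hI hl hdim
    (hasRegSeq_of_le_grade hgrade.ge) (hasRegSeq_of_le_grade hG)
  rw [hr]
  exact ⟨hle, fun h => le_antisymm (hge (hasRegSeq_of_le_grade h)) hle⟩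

/-- The quotient map `R → R ⧸ K`, where the semiring structure of the target is spelled as the one
underlying its commutative ring structure. -/
def quotientMap {R : Type*} [CommRing R] (K : Ideal R) :
    @RingHom R (R ⧸ K) _ (@Semiring.toNonAssocSemiring _ (@CommSemiring.toSemiring _
      (@CommRing.toCommSemiring _ (Ideal.Quotient.commRing K)))) :=
  Ideal.Quotient.mk K

theorem quotientMap_surjective {R : Type*} [CommRing R] (K : Ideal R) :
    Function.Surjective (quotientMap K) :=
  Ideal.Quotient.mk_surjective

theorem quotientMap_eq_zero_iff {R : Type*} [CommRing R] (K : Ideal R) (p : R) :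
    quotientMap K p = (@OfNat.ofNat _ 0 (@Zero.toOfNat0 _ (@MulZeroClass.toZero _
      (@NonUnitalNonAssocSemiring.toMulZeroClass _
        (@NonAssocSemiring.toNonUnitalNonAssocSemiring _ (@Semiring.toNonAssocSemiring _
          (@CommSemiring.toSemiring _
            (@CommRing.toCommSemiring _ (Ideal.Quotient.commRing K))))))))) ↔ p ∈ K :=
  Ideal.Quotient.eq_zero_iff_mem

/-- The canonical map `R(I) → R(I) / J R(I)`. -/
def reesQuotientMap {A : Type*} [CommRing A] (I J : Ideal A) :
    @RingHom (reesAlgebra I) (ReesQuotient I J) _ (@Semiring.toNonAssocSemiring _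
      (@CommSemiring.toSemiring _ (@CommRing.toCommSemiring _ (Ideal.Quotient.commRing _)))) :=
  quotientMap (J.map (algebraMap A (reesAlgebra I)))

theorem reesQuotientPiece_eq_piece {A : Type*} [CommRing A] (I J : Ideal A) :
    reesQuotientPiece I J =
      @piece A _ I (ReesQuotient I J) (Ideal.Quotient.commRing _) (reesQuotientMap I J) :=
  rfl

theorem reesQuotientMap_surjective {A : Type*} [CommRing A] (I J : Ideal A) :
    Function.Surjective (reesQuotientMap I J) :=
  quotientMap_surjective _

end FiberConeReg

end

theorem mainTheorem4 {A : Type*} [CommRing A] [IsNoetherianRing A] [IsLocalRing A]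
    [Infinite (IsLocalRing.ResidueField A)] (I : Ideal A) (hI : I ≠ ⊤)
    (l : ℕ) (hl : 0 < l) (hspread : FiberConeReg.analyticSpread I = (l : WithBot ℕ∞))
    (hgrade : FiberConeReg.grade I = (l : ℕ∞))
    (hG : ((l - 1 : ℕ) : ℕ∞) ≤ FiberConeReg.gradeAssocGradedPlus I) :
    FiberConeReg.regAssocGraded I ≤ FiberConeReg.regFiberCone I ∧
      (((l - 1 : ℕ) : ℕ∞) ≤ FiberConeReg.depthFiberCone I →
        FiberConeReg.regFiberCone I = FiberConeReg.regAssocGraded I) := by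
  exact @FiberConeReg.reg_le_reg_and_eq A (FiberConeReg.AssocGraded I) (FiberConeReg.FiberCone I)
    _ _ _ _ I (Ideal.Quotient.commRing _) (Ideal.Quotient.commRing _)
    (FiberConeReg.reesQuotientMap I I)
    (FiberConeReg.reesQuotientMap I (IsLocalRing.maximalIdeal A))
    (FiberConeReg.reesQuotientMap_surjective I I) (FiberConeReg.quotientMap_eq_zero_iff _)
    (FiberConeReg.reesQuotientMap_surjective I _) (FiberConeReg.quotientMap_eq_zero_iff _)
    _ _ (FiberConeReg.reesQuotientPiece_eq_piece I I)
    (FiberConeReg.reesQuotientPiece_eq_piece I _) hI l hl hspread hgrade hG
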